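/- Let $n\ge 1$ and $N\ge 0$. Let $A\in\mathbb{R}^{n\times n}$ have ones on the superdiagonal and zeros elsewhere, let $B=(0,\dots,0,1)^\top\in\mathbb{R}^n$ and $\eta_1=(1,0,\dots,0)^\top\in\mathbb{R}^n$. Consider agents $\dot x_i=Ax_i+Bu_i$, $i=0,\dots,N$, with a leader $0$, $u_0=0$, and consensus errors $e_i=x_i-x_0$, $e=(e_1^\top,\dots,e_N^\top)^\top\in\mathbb{R}^{Nn}$. The agents communicate over a directed graph on $\{0,\dots,N\}$ without self-loops, in which $(i,j)$ is an edge if $j$ sends information to $i$; the leader receives nothing, and every follower is the end of a directed path starting at the leader. Put $w_{ij}=1$ if $(i,j)$ is an edge and $w_{ij}=0$ otherwise. The transmitted vectors are given by $$v_0=0,\qquad v_i=\frac{1}{\sum_{j=0}^N w_{ij}}\sum_{j=0}^N w_{ij}\,(x_i-x_j+v_j),\quad i=1,\dots,N .$$ Let $\mu\in[-1,0)$, $\lambda>0$, $K_{lin}=\eta_1^\top(A+\lambda I)^n$, $G_{\mathbf d}=\mathrm{diag}\{1-\mu(n-k)\}_{k=1}^n$, $\mathbf d(s)=\exp(sG_{\mathbf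 d})$, and let $H$ be the matrix with rows $h_k=-\eta_1^\top(A+\lambda I)^{k-1}$, $k=1,\dots,n$. Let $P\in\mathbb{R}^{n\times n}$ satisfy (where $\succ 0$, $\prec 0$ mean symmetric and positive, negative definite) $$P\succ0,\qquad PG_{\mathbf d}+G_{\mathbf d}P\succ0,\qquad P(A-BK_{lin})+(A-BK_{lin})^\top P\prec0 ,$$ let $\|z\|_P=\sqrt{z^\top Pz}$, and let $\|\cdot\|_{\mathbf d}$ be the canonical homogeneous norm: $\|0\|_{\mathbf d}=0$ and $\|z\|_{\mathbf d}=e^{s}$ with $\|\mathbf d(-s)z\|_P=1$ for $z\neq0$. Apply the protocol $$u_i=-\|v_i\|_{\mathbf d}^{1+\mu}K_{lin}\,\mathbf d(-\ln\|v_i\|_{\mathbf d})\,v_i,\qquad i=1,\dots,N$$ (with $u_i=0$ where $v_i=0$). Define $$\Sigma=\{e:\eta_1^\top e_i\le0\ \forall i\},\quad \Omega=\{e:He_i\ge0\ \forall i\},\quad \Omega_{\mathbf d}=\{e:H\mathbf d(-\ln\|e_i\|_{\mathbf d})e_i\ge0\ \forall i\},$$ where inequalities between vectors are componentwise and the vector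 in the definition of $\Omega_{\mathbf d}$ is $0$ if $e_i=0$. Solutions of differential equations are understood in the sense of Filippov (these are the classical ones where the right-hand side is continuous). Then: 1. For every $z\ne0$ there is exactly one $s$ with $\|\mathbf d(-s)z\|_P=1$, and for all $x_0,\dots,x_N$ the equations for the transmitted vectors have exactly one solution $(v_0,\dots,v_N)$. 2. The consensus error obeys an autonomous equation $\dot e=f(e)$, $f:\mathbb{R}^{Nn}\to\mathbb{R}^{Nn}$. This equation is globally finite-time stable: from every initial value there is a solution on $[0,\infty)$; the origin is Lyapunov stable; and there is a function $T:\mathbb{R}^{Nn}\to(0,\infty)$ such that every solution satisfies $e(t)=0$ for all $t\ge T(e(0))$. 3. $\Omega_{\mathbf d}$ is a homogeneous cone (it is non-empty, and $(\mathbf d(s)e_i)_i\in\Omega_{\mathbf d}$ for all $e\in\Omega_{\mathbf d}$, $s\in\mathbb{R}$), and it is strictly positively invariant: every solution of $\dot e=f(e)$ with $e(0)\in\Omega_{\mathbf d}$ satisfies $e(t)\in\Omega_{\mathbf d}$ for all $t\ge0$. 4. $\Omega\subset\Sigma$ and $\Omega_{\mathbf d}\subset\Sigma$; and $e(0)\in\Omega_{\mathbf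 d}$ whenever $e(0)\in\Omega$ and $\|e_i(0)\|_P\le1$ for all $i=1,\dots,N$. -/

import Mathlib

open MeasureTheory
open scoped Matrix

namespace NonOvershoot

/-! ### Agent dynamics, communication network, transmitted data -/

/-- The chain-of-integrators matrix: ones on the superdiagonal, zeros elsewhere. -/
def chainA (n : ℕ) : Matrix (Fin n) (Fin n) ℝ :=
  Matrix.of fun i j => if (i : ℕ) + 1 = (j : ℕ) then 1 else 0

/-- The input vector `B = (0, …, 0, 1)ᵀ`. -/
def inputB (n : ℕ) : Fin n → ℝ := fun i => if (i : ℕ) + 1 = n then 1 else 0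

/-- The first vector `η₁ = (1, 0, …, 0)ᵀ` of the canonical basis. -/
def eta1 (n : ℕ) : Fin n → ℝ := fun i => if (i : ℕ) = 0 then 1 else 0

/-- Vertex `0` is the leader, vertices `1, …, N` are the followers, and `G.Adj i j` means that
`(i, j)` is an edge, i.e. that agent `j` transfers its information to agent `i`.  There are no
self-loops, the leader receives nothing, and every follower is the end of a directed path that
starts at the leader. -/
structure IsLeaderFollower {N : ℕ} (G : Digraph (Fin (N + 1))) : Prop where
  no_loop : ∀ i, ¬ G.Adj i i
  leader_source : ∀ j, ¬ G.Adj 0 j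
  reachable : ∀ i, i ≠ 0 → Relation.TransGen (fun j i => G.Adj i j) 0 i

open Classical in
/-- Entries of the adjacency matrix: `w i j = 1` if `(i, j)` is an edge and `0` otherwise. -/
noncomputable def weight {N : ℕ} (G : Digraph (Fin (N + 1))) (i j : Fin (N + 1)) : ℝ :=
  if G.Adj i j then 1 else 0

/-- The implicit equations for the transmitted vectors: `v 0 = 0` and
`v i = (∑ⱼ w i j)⁻¹ ∑ⱼ w i j (x i - x j + v j)` for every follower `i`. -/
def IsTransmitted {N n : ℕ} (G : Digraph (Fin (N + 1)))
    (x v : Fin (N + 1) → Fin n → ℝ) : Prop :=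
  v 0 = 0 ∧ ∀ i, i ≠ 0 →
    v i = (1 / ∑ j, weight G i j) • ∑ j, weight G i j • (x i - x j + v j)

/-! ### The dilation, the canonical homogeneous norm, the protocol -/

/-- The generator `G_d = diag {1 - μ (n - k)}`, `k = 1, …, n`. -/
noncomputable def generator (n : ℕ) (μ : ℝ) : Matrix (Fin n) (Fin n) ℝ :=
  Matrix.diagonal fun k => 1 - μ * ((n : ℝ) - ((k : ℕ) + 1 : ℝ))

/-- The linear dilation `d(s) = exp(s G_d)`. -/
noncomputable def dil (n : ℕ) (μ s : ℝ) : Matrix (Fin n) (Fin n) ℝ :=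
  NormedSpace.exp (s • generator n μ)

/-- The weighted Euclidean norm `‖x‖_P = √(xᵀ P x)`. -/
noncomputable def pNorm {n : ℕ} (P : Matrix (Fin n) (Fin n) ℝ) (x : Fin n → ℝ) : ℝ :=
  Real.sqrt (x ⬝ᵥ (P *ᵥ x))

open Classical in
/-- The canonical homogeneous norm induced by `‖·‖_P`: `‖0‖_d = 0` and `‖x‖_d = exp s` with
`‖d(-s) x‖_P = 1` for `x ≠ 0`. -/
noncomputable def homNorm {n : ℕ} (μ : ℝ) (P : Matrix (Fin n) (Fin n) ℝ) (x : Fin n → ℝ) : ℝ :=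
  if x = 0 then 0
  else Real.exp (Classical.epsilon fun s : ℝ => pNorm P (dil n μ (-s) *ᵥ x) = 1)

/-- The projection `d(-ln ‖x‖_d) x` of `x` to the unit sphere. -/
noncomputable def homProj {n : ℕ} (μ : ℝ) (P : Matrix (Fin n) (Fin n) ℝ) (x : Fin n → ℝ) :
    Fin n → ℝ :=
  dil n μ (-Real.log (homNorm μ P x)) *ᵥ x

/-- The linear gain `K_lin = η₁ᵀ (A + λ I)ⁿ`. -/
noncomputable def gainLin (n : ℕ) (lam : ℝ) : Fin n → ℝ :=
  eta1 n ᵥ* (chainA n + lam • (1 : Matrix (Fin n) (Fin n) ℝ)) ^ n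

/-- The matrix `A - B K_lin`. -/
noncomputable def closedLoopMatrix (n : ℕ) (lam : ℝ) : Matrix (Fin n) (Fin n) ℝ :=
  chainA n - Matrix.vecMulVec (inputB n) (gainLin n lam)

/-- The homogeneous feedback `v ↦ -‖v‖_d ^ (1 + μ) K_lin d(-ln ‖v‖_d) v`. -/
noncomputable def protocol {n : ℕ} (μ lam : ℝ) (P : Matrix (Fin n) (Fin n) ℝ)
    (v : Fin n → ℝ) : ℝ :=
  -(homNorm μ P v ^ (1 + μ) * (gainLin n lam ⬝ᵥ homProj μ P v))

/-- The velocity `A xᵢ + B uᵢ` of agent `i`, with `u₀ = 0` for the leader and the homogeneous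
protocol applied to the transmitted vector for the followers. -/
noncomputable def agentVelocity {N n : ℕ} (μ lam : ℝ) (P : Matrix (Fin n) (Fin n) ℝ)
    (x v : Fin (N + 1) → Fin n → ℝ) (i : Fin (N + 1)) : Fin n → ℝ :=
  chainA n *ᵥ x i + (if i = 0 then 0 else protocol μ lam P (v i)) • inputB n

/-- The consensus error `e i = x i - x 0`, `i = 1, …, N`. -/
def consensusError {N n : ℕ} (x : Fin (N + 1) → Fin n → ℝ) : Fin N → Fin n → ℝ :=
  fun i => x i.succ - x 0

/-- `e' = f e` is the closed-loop error equation: in every state `x` of the network, with the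
transmitted vectors `v` belonging to it, `f` maps the consensus error to the velocity of the
consensus error. -/
def IsErrorField {N n : ℕ} (G : Digraph (Fin (N + 1))) (μ lam : ℝ)
    (P : Matrix (Fin n) (Fin n) ℝ)
    (f : (Fin N → Fin n → ℝ) → (Fin N → Fin n → ℝ)) : Prop :=
  ∀ x v, IsTransmitted G x v →
    f (consensusError x) = consensusError (agentVelocity μ lam P x v)

/-! ### The cones -/

/-- The matrix `H` with rows `h_k = -η₁ᵀ (A + λ I)^(k-1)`, `k = 1, …, n`. -/
noncomputable def matH (n : ℕ) (lam : ℝ) : Matrix (Fin n) (Fin n) ℝ :=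
  Matrix.of fun k => -(eta1 n ᵥ* (chainA n + lam • (1 : Matrix (Fin n) (Fin n) ℝ)) ^ (k : ℕ))

/-- The set `Σ` of errors whose first components are all nonpositive. -/
def setSigma (N n : ℕ) : Set (Fin N → Fin n → ℝ) :=
  {e | ∀ i, eta1 n ⬝ᵥ e i ≤ 0}

/-- The linear cone `Ω = {e : H eᵢ ≥ 0 for all i}`. -/
def coneLin (N n : ℕ) (lam : ℝ) : Set (Fin N → Fin n → ℝ) :=
  {e | ∀ i, 0 ≤ matH n lam *ᵥ e i}

/-- The homogeneous cone `Ω_d = {e : H d(-ln ‖eᵢ‖_d) eᵢ ≥ 0 for all i}`. -/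
def coneHom (N : ℕ) {n : ℕ} (μ lam : ℝ) (P : Matrix (Fin n) (Fin n) ℝ) :
    Set (Fin N → Fin n → ℝ) :=
  {e | ∀ i, 0 ≤ matH n lam *ᵥ homProj μ P (e i)}

/-- A homogeneous cone: a nonempty set invariant under the dilation `e ↦ (d(s) eᵢ)ᵢ`. -/
def IsHomogeneousCone {N n : ℕ} (μ : ℝ) (S : Set (Fin N → Fin n → ℝ)) : Prop :=
  S.Nonempty ∧ ∀ e ∈ S, ∀ s : ℝ, (fun i => dil n μ s *ᵥ e i) ∈ S

/-! ### Solutions, stability, invariance -/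

section ODE

variable {E : Type*} [NormedAddCommGroup E] [NormedSpace ℝ E] [MeasureSpace E]

/-- The Filippov regularization of a vector field:
`F(x) = ⋂_{δ > 0} ⋂_{vol Z = 0} closure (conv f(B(x, δ) \ Z))`. -/
def filippov (f : E → E) (x : E) : Set E :=
  ⋂ (δ : ℝ) (_ : 0 < δ) (Z : Set E) (_ : volume Z = 0),
    closure (convexHull ℝ (f '' (Metric.ball x δ \ Z)))

/-- `x` is a Filippov solution of `x' = f x` on `[0, τ]`: it is absolutely continuous, i.e. the
integral of an integrable function `g`, and its derivative satisfies `g t ∈ F(x t)` for almost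
every `t`.  Where `f` is continuous these are the classical solutions. -/
def IsSolutionOn (f : E → E) (τ : ℝ) (x : ℝ → E) : Prop :=
  ∃ g : ℝ → E, IntervalIntegrable g volume 0 τ ∧
    (∀ᵐ t ∂(volume.restrict (Set.Icc 0 τ)), g t ∈ filippov f (x t)) ∧
    ∀ t ∈ Set.Icc 0 τ, x t = x 0 + ∫ s in (0 : ℝ)..t, g s

/-- Every initial value is the starting point of a solution on `[0, ∞)`. -/
def HasGlobalSolutions (f : E → E) : Prop :=
  ∀ x₀ : E, ∃ x : ℝ → E, x 0 = x₀ ∧ ∀ τ, 0 < τ → IsSolutionOn f τ x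

/-- Lyapunov stability of the origin, for all solutions. -/
def LyapunovStable (f : E → E) : Prop :=
  ∀ ε > 0, ∃ δ > 0, ∀ τ > 0, ∀ x : ℝ → E, IsSolutionOn f τ x → ‖x 0‖ < δ →
    ∀ t ∈ Set.Icc 0 τ, ‖x t‖ < ε

/-- Global finite-time stability: solutions exist globally, the origin is Lyapunov stable, and
there is a settling-time function `T` such that all solutions vanish from time `T (x 0)` on. -/
def GloballyFiniteTimeStable (f : E → E) : Prop :=
  HasGlobalSolutions f ∧ LyapunovStable f ∧
    ∃ T : E → ℝ, (∀ x₀, 0 < T x₀) ∧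
      ∀ τ > 0, ∀ x : ℝ → E, IsSolutionOn f τ x → ∀ t ∈ Set.Icc 0 τ, T (x 0) ≤ t → x t = 0

/-- Positive invariance, for all solutions: `x 0 ∈ S` implies `x t ∈ S` for all `t ≥ 0`. -/
def StrictlyPositivelyInvariant (f : E → E) (S : Set E) : Prop :=
  ∀ τ > 0, ∀ x : ℝ → E, IsSolutionOn f τ x → x 0 ∈ S → ∀ t ∈ Set.Icc 0 τ, x t ∈ S

end ODE

end NonOvershoot

open NonOvershoot

/-! The transmitted vectors are the errors themselves: `x i - x 0` solves the defining equations,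
and a discrete maximum principle on the graph (`nonpos_of_average`) excludes any other solution. The
error equation therefore splits into N copies of one equation z' = φ(z) with φ = `agentField`.

For z ≠ 0 write z = d(ℓ) y with ℓ = ln ‖z‖_d and y on the unit sphere of ‖·‖_P, and put M = A - B
K_lin. Since A shifts the dilation weights by μ and B has weight 1, φ(z) = e^{μℓ} d(ℓ) M y.
Differentiating yᵀPy = 1 gives, off the origin, ℓ' = e^{μℓ} r(y) and y' = e^{μℓ} (M y - r(y) G_d y),
where r = `decayRate` ≤ -c < 0 by the matrix inequalities. Hence (e^{-μℓ})' = -μ r(y) ≤ μc < 0: the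
power ‖z‖_d^{-μ} falls at least at a constant rate (`exists_homNorm_rpow_decrease`). This yields
stability, a finite settling time, and the fact that a solution never leaves the origin.

For the cone, ξ = H y satisfies ξ' = e^{μℓ} (A - λI - r H G_d H⁻¹) ξ. The off-diagonal entries of H
G_d H⁻¹ are nonnegative because μ < 0 < λ, and r < 0, so the coefficient matrix is Metzler and
preserves ξ ≥ 0 (`nonneg_of_metzler`). The same principle for ξ' = H G_d H⁻¹ ξ along the dilation
carries points of Ω with all ‖e_i‖_P ≤ 1 into Ω_d.

Solutions exist because, after a change of time, the equation for y is polynomial on a compact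
sphere; undoing the change gives a trajectory that reaches the origin in finite time and is
continued by zero. The Filippov inclusion is treated component by component: it is single-valued in
the components with e_i ≠ 0 (`filippov_apply_eq`), and oddness of φ puts the value 0 into it in the
others (`mem_filippov_of_odd`). -/

namespace NonOvershoot

/-! ### Algebra of the dilation and of the chain of integrators -/

/-- The weights of the dilation, i.e. the diagonal entries of `generator n μ`. -/
noncomputable def dilWeight (n : ℕ) (μ : ℝ) (k : Fin n) : ℝ :=
  1 - μ * ((n : ℝ) - ((k : ℕ) + 1 : ℝ))

lemma one_le_dilWeight {n : ℕ} {μ : ℝ} (hμ : μ ≤ 0) (k : Fin n) : 1 ≤ dilWeight n μ k := by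
  have h : ((k : ℕ) : ℝ) + 1 ≤ n := by exact_mod_cast k.2
  unfold dilWeight
  nlinarith

lemma generator_mulVec_apply {n : ℕ} (μ : ℝ) (z : Fin n → ℝ) (k : Fin n) :
    (generator n μ *ᵥ z) k = dilWeight n μ k * z k := by
  simp [generator, Matrix.mulVec_diagonal, dilWeight]

lemma dil_eq_diagonal (n : ℕ) (μ s : ℝ) :
    dil n μ s = Matrix.diagonal fun k => Real.exp (s * dilWeight n μ k) := by
  rw [dil, generator, ← Matrix.diagonal_smul, Matrix.exp_diagonal]
  congr 1
  ext k
  rw [Pi.coe_exp, Real.exp_eq_exp_ℝ]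
  rfl

lemma dil_mulVec_apply {n : ℕ} (μ s : ℝ) (z : Fin n → ℝ) (k : Fin n) :
    (dil n μ s *ᵥ z) k = Real.exp (s * dilWeight n μ k) * z k := by
  simp [dil_eq_diagonal, Matrix.mulVec_diagonal]

lemma dil_add_mulVec {n : ℕ} (μ s t : ℝ) (z : Fin n → ℝ) :
    dil n μ (s + t) *ᵥ z = dil n μ s *ᵥ (dil n μ t *ᵥ z) := by
  ext k
  simp only [dil_mulVec_apply, add_mul, Real.exp_add, mul_assoc]

lemma dil_zero_mulVec {n : ℕ} (μ : ℝ) (z : Fin n → ℝ) : dil n μ 0 *ᵥ z = z := by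
  ext k
  simp [dil_mulVec_apply]

lemma dil_mulVec_eq_zero {n : ℕ} {μ s : ℝ} {z : Fin n → ℝ} :
    dil n μ s *ᵥ z = 0 ↔ z = 0 := by
  simp [funext_iff, dil_mulVec_apply, Real.exp_ne_zero]

lemma chainA_mulVec_apply {n : ℕ} (z : Fin n → ℝ) (k : Fin n) :
    (chainA n *ᵥ z) k = if h : (k : ℕ) + 1 < n then z ⟨k + 1, h⟩ else 0 := by
  simp only [Matrix.mulVec, dotProduct, chainA, Matrix.of_apply, ite_mul, one_mul, zero_mul]
  split_ifs with h
  · rw [Finset.sum_eq_single ⟨k + 1, h⟩]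
    · simp
    · intro j _ hj
      rw [if_neg]
      exact fun h' => hj (Fin.ext h'.symm)
    · simp
  · refine Finset.sum_eq_zero fun j _ => if_neg ?_
    have := j.2
    omega

/-- Consecutive dilation weights differ by μ, so the shift A is homogeneous of degree μ. -/
lemma chainA_mulVec_dil {n : ℕ} (μ s : ℝ) (z : Fin n → ℝ) :
    chainA n *ᵥ (dil n μ s *ᵥ z) = Real.exp (μ * s) • dil n μ s *ᵥ (chainA n *ᵥ z) := by
  ext k
  simp only [Pi.smul_apply, dil_mulVec_apply, chainA_mulVec_apply, smul_eq_mul]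
  split_ifs with h
  · rw [← mul_assoc, ← Real.exp_add]
    congr 2
    simp only [dilWeight]
    push_cast
    ring
  · simp

/-- The last weight is 1; this is why the feedback carries the exponent 1 + μ. -/
lemma dil_mulVec_inputB (n : ℕ) (μ s : ℝ) :
    dil n μ s *ᵥ inputB n = Real.exp s • inputB n := by
  ext k
  simp only [Pi.smul_apply, dil_mulVec_apply, inputB, smul_eq_mul]
  split_ifs with h
  · have : ((k : ℕ) : ℝ) + 1 = n := by exact_mod_cast h
    simp [dilWeight, this]
  · simp

/-- The shifted chain `A + λ I`. -/
noncomputable abbrev shiftedChain (n : ℕ) (lam : ℝ) : Matrix (Fin n) (Fin n) ℝ :=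
  chainA n + lam • (1 : Matrix (Fin n) (Fin n) ℝ)

/-- The functional `η₁ᵀ (A + λ I)^m`. -/
noncomputable def chainRow (n : ℕ) (lam : ℝ) (m : ℕ) (z : Fin n → ℝ) : ℝ :=
  eta1 n ⬝ᵥ (shiftedChain n lam ^ m *ᵥ z)

lemma matH_mulVec_apply {n : ℕ} (lam : ℝ) (z : Fin n → ℝ) (k : Fin n) :
    (matH n lam *ᵥ z) k = -chainRow n lam k z := by
  simp only [matH, chainRow, Matrix.dotProduct_mulVec]
  exact neg_dotProduct _ _

lemma gainLin_dotProduct {n : ℕ} (lam : ℝ) (z : Fin n → ℝ) :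
    gainLin n lam ⬝ᵥ z = chainRow n lam n z := by
  simp [gainLin, chainRow, Matrix.dotProduct_mulVec]

lemma eta1_dotProduct {n : ℕ} (hn : 0 < n) (z : Fin n → ℝ) : eta1 n ⬝ᵥ z = z ⟨0, hn⟩ := by
  simp only [dotProduct, eta1, ite_mul, one_mul, zero_mul]
  rw [Finset.sum_eq_single ⟨0, hn⟩]
  · simp
  · intro j _ hj
    rw [if_neg]
    exact fun h' => hj (Fin.ext h')
  · simp

lemma chainRow_add {n : ℕ} (lam : ℝ) (m : ℕ) (z z' : Fin n → ℝ) :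
    chainRow n lam m (z + z') = chainRow n lam m z + chainRow n lam m z' := by
  simp [chainRow, Matrix.mulVec_add, dotProduct_add]

lemma chainRow_sub {n : ℕ} (lam : ℝ) (m : ℕ) (z z' : Fin n → ℝ) :
    chainRow n lam m (z - z') = chainRow n lam m z - chainRow n lam m z' := by
  simp [chainRow, Matrix.mulVec_sub, dotProduct_sub]

lemma chainRow_smul {n : ℕ} (lam : ℝ) (m : ℕ) (c : ℝ) (z : Fin n → ℝ) :
    chainRow n lam m (c • z) = c * chainRow n lam m z := by
  simp [chainRow, Matrix.mulVec_smul]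

lemma chainRow_succ {n : ℕ} (lam : ℝ) (m : ℕ) (z : Fin n → ℝ) :
    chainRow n lam (m + 1) z = chainRow n lam m (shiftedChain n lam *ᵥ z) := by
  simp [chainRow, pow_succ]

lemma chainRow_zero {n : ℕ} (lam : ℝ) (z : Fin n → ℝ) :
    chainRow n lam 0 z = eta1 n ⬝ᵥ z := by
  simp [chainRow]

lemma shiftedChain_mulVec {n : ℕ} (lam : ℝ) (z : Fin n → ℝ) :
    shiftedChain n lam *ᵥ z = chainA n *ᵥ z + lam • z := by
  simp [shiftedChain, Matrix.add_mulVec, Matrix.smul_mulVec]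

lemma chainRow_chainA {n : ℕ} (lam : ℝ) (m : ℕ) (z : Fin n → ℝ) :
    chainRow n lam m (chainA n *ᵥ z) = chainRow n lam (m + 1) z - lam * chainRow n lam m z := by
  rw [chainRow_succ, shiftedChain_mulVec, chainRow_add, chainRow_smul]
  ring

/-- A vector that vanishes up to index `m` is annihilated by `η₁ᵀ (A + λ I)^m`, and only its
`m`-th entry matters if it vanishes below `m`. -/
lemma chainRow_of_vanish {n : ℕ} (lam : ℝ) (m : ℕ) (hm : m < n) (z : Fin n → ℝ)
    (hz : ∀ j : Fin n, (j : ℕ) < m → z j = 0) : chainRow n lam m z = z ⟨m, hm⟩ := by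
  induction m generalizing z with
  | zero => rw [chainRow_zero, eta1_dotProduct hm]
  | succ m ih =>
    rw [chainRow_succ, ih (by omega)]
    · rw [shiftedChain_mulVec]
      simp [chainA_mulVec_apply, hm, hz ⟨m, by omega⟩]
    · intro j hj
      rw [shiftedChain_mulVec]
      have h1 : (j : ℕ) + 1 < n := by omega
      simp [chainA_mulVec_apply, h1, hz j (by omega), hz ⟨j + 1, h1⟩ (by simpa using hj)]

lemma chainRow_inputB {n : ℕ} (lam : ℝ) (m : ℕ) (hm : m < n) :
    chainRow n lam m (inputB n) = if m + 1 = n then 1 else 0 := by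
  rw [chainRow_of_vanish lam m hm]
  · simp [inputB]
  · intro j hj
    rw [inputB, if_neg]
    omega

lemma chainA_mulVec_generator {n : ℕ} (μ : ℝ) (z : Fin n → ℝ) :
    chainA n *ᵥ (generator n μ *ᵥ z) =
      generator n μ *ᵥ (chainA n *ᵥ z) + μ • (chainA n *ᵥ z) := by
  ext k
  simp only [Pi.add_apply, Pi.smul_apply, generator_mulVec_apply, chainA_mulVec_apply, smul_eq_mul]
  split_ifs with h
  · simp only [dilWeight]
    push_cast
    ring
  · simp

/-- From A G = G A + μ A one gets (A + λI) G = G (A + λI) + μ (A + λI) - μλ I, and induction on m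
follows. The truncated `m - 1` is harmless at m = 0 because of the factor m. -/
lemma chainRow_generator {n : ℕ} (hn : 0 < n) (μ lam : ℝ) (m : ℕ) (z : Fin n → ℝ) :
    chainRow n lam m (generator n μ *ᵥ z) =
      (1 - μ * ((n : ℝ) - (m + 1))) * chainRow n lam m z
        - m * μ * lam * chainRow n lam (m - 1) z := by
  induction m generalizing z with
  | zero =>
    simp only [chainRow_zero, eta1_dotProduct hn, generator_mulVec_apply, dilWeight]
    simp
  | succ m ih =>
    have key : shiftedChain n lam *ᵥ (generator n μ *ᵥ z) =
        generator n μ *ᵥ (shiftedChain n lam *ᵥ z) + μ • (shiftedChain n lam *ᵥ z)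
          - (μ * lam) • z := by
      simp only [shiftedChain_mulVec, chainA_mulVec_generator, Matrix.mulVec_add,
        Matrix.mulVec_smul, smul_add, smul_smul]
      abel
    rw [chainRow_succ, key, chainRow_sub, chainRow_add, chainRow_smul, chainRow_smul, ih,
      ← chainRow_succ]
    rcases m with _ | m
    · simp
      ring
    · simp only [Nat.add_sub_cancel]
      rw [← chainRow_succ]
      push_cast
      ring

lemma closedLoopMatrix_mulVec {n : ℕ} (lam : ℝ) (z : Fin n → ℝ) :
    closedLoopMatrix n lam *ᵥ z = chainA n *ᵥ z - (gainLin n lam ⬝ᵥ z) • inputB n := by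
  rw [closedLoopMatrix, Matrix.sub_mulVec, Matrix.vecMulVec_mulVec]
  simp

/-- In the coordinates `H z` the closed loop is the chain `A - λ I`. -/
lemma matH_mulVec_closedLoop {n : ℕ} (lam : ℝ) (z : Fin n → ℝ) :
    matH n lam *ᵥ (closedLoopMatrix n lam *ᵥ z) =
      (chainA n - lam • (1 : Matrix (Fin n) (Fin n) ℝ)) *ᵥ (matH n lam *ᵥ z) := by
  ext k
  rw [Matrix.sub_mulVec, Pi.sub_apply, chainA_mulVec_apply, closedLoopMatrix_mulVec]
  simp only [Matrix.smul_mulVec, Matrix.one_mulVec, Pi.smul_apply, smul_eq_mul,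
    matH_mulVec_apply, chainRow_sub, chainRow_smul, chainRow_chainA, chainRow_inputB lam k k.2,
    gainLin_dotProduct]
  have hk := k.2
  -- In the last row the feedback cancels η₁ᵀ(A + λI)ⁿz; the other rows annihilate B.
  by_cases h : (k : ℕ) + 1 = n
  · simp [h]
  · rw [dif_pos (by omega)]
    simp [h]
    ring

/-- The matrix `H G_d H⁻¹`. -/
noncomputable def generatorH (n : ℕ) (μ lam : ℝ) : Matrix (Fin n) (Fin n) ℝ :=
  generator n μ + Matrix.of fun k j : Fin n =>
    if (j : ℕ) + 1 = (k : ℕ) then -((k : ℕ) : ℝ) * μ * lam else 0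

lemma matH_mulVec_generator {n : ℕ} (μ lam : ℝ) (z : Fin n → ℝ) :
    matH n lam *ᵥ (generator n μ *ᵥ z) = generatorH n μ lam *ᵥ (matH n lam *ᵥ z) := by
  ext k
  rw [generatorH, Matrix.add_mulVec, Pi.add_apply, generator_mulVec_apply,
    matH_mulVec_apply, matH_mulVec_apply, chainRow_generator (by have := k.2; omega)]
  simp only [Matrix.mulVec, dotProduct, Matrix.of_apply, ite_mul, zero_mul]
  obtain ⟨k, hk⟩ := k
  rcases k with _ | k
  · simp [dilWeight]
  · rw [Finset.sum_eq_single ⟨k, by omega⟩]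
    · have := matH_mulVec_apply lam z ⟨k, by omega⟩
      simp only [Matrix.mulVec, dotProduct] at this
      simp only [this, dilWeight]
      simp
      ring
    · intro j _ hj
      rw [if_neg]
      exact fun h' => hj (Fin.ext (by simpa using h'))
    · simp

/-- The only off-diagonal entries that can be nonzero are the subdiagonal ones -kμλ; the sign
condition on μ enters the cone argument here. -/
lemma generatorH_nonneg {n : ℕ} {μ lam : ℝ} (hμ : μ ≤ 0) (hlam : 0 ≤ lam) {i j : Fin n}
    (hij : i ≠ j) : 0 ≤ generatorH n μ lam i j := by
  simp only [generatorH, generator, Matrix.add_apply, Matrix.diagonal_apply_ne _ hij,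
    Matrix.of_apply, zero_add]
  split_ifs
  · have : (0 : ℝ) ≤ ((i : ℕ) : ℝ) := Nat.cast_nonneg _
    have h1 : 0 ≤ ((i : ℕ) : ℝ) * (-μ) * lam := by
      have : 0 ≤ -μ := by linarith
      positivity
    linarith
  · exact le_rfl

lemma chainA_sub_nonneg {n : ℕ} {lam : ℝ} {i j : Fin n} (hij : i ≠ j) :
    0 ≤ (chainA n - lam • (1 : Matrix (Fin n) (Fin n) ℝ)) i j := by
  simp only [chainA, Matrix.sub_apply, Matrix.smul_apply, Matrix.one_apply_ne hij, Matrix.of_apply]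
  split_ifs <;> simp

/-! ### Linear systems with nonnegative off-diagonal coefficients -/

/-- The squared negative part is differentiable even at 0, so it can serve as an energy for
violations of nonnegativity. -/
lemma hasDerivAt_min_zero_sq (u : ℝ) : HasDerivAt (fun v : ℝ => min v 0 ^ 2) (2 * min u 0) u := by
  rcases lt_trichotomy u 0 with h | h | h
  · have h1 : HasDerivAt (fun v : ℝ => v ^ 2) (2 * u) u := by simpa using hasDerivAt_pow 2 u
    rw [min_eq_left h.le]
    refine h1.congr_of_eventuallyEq ?_
    filter_upwards [Iio_mem_nhds h] with v hv
    rw [min_eq_left (le_of_lt hv)]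
  · subst h
    have h2 : HasDerivAt (fun v : ℝ => v ^ 2) 0 0 := by simpa using hasDerivAt_pow 2 (0 : ℝ)
    rw [hasDerivAt_iff_isLittleO] at h2 ⊢
    simp only [min_self, mul_zero, smul_zero, sub_zero] at h2 ⊢
    refine Asymptotics.IsBigO.trans_isLittleO ?_ h2
    refine Asymptotics.IsBigO.of_norm_le fun v => ?_
    simp only [Real.norm_eq_abs]
    rcases le_total v 0 with hv | hv
    · simp [min_eq_left hv]
    · simp [min_eq_right hv, sq_nonneg]
  · rw [min_eq_right h.le, mul_zero]
    refine (hasDerivAt_const u (0 : ℝ)).congr_of_eventuallyEq ?_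
    filter_upwards [Ioi_mem_nhds h] with v hv
    rw [min_eq_right (le_of_lt hv)]
    simp

/-- A linear system `ξ' = a(t) ξ` with bounded coefficients and nonnegative off-diagonal entries
preserves nonnegativity. -/
lemma nonneg_of_metzler {n : ℕ} {ξ : ℝ → Fin n → ℝ} {a : ℝ → Matrix (Fin n) (Fin n) ℝ}
    {t₀ t₁ D : ℝ} (ht : t₀ ≤ t₁) (hc : ContinuousOn ξ (Set.Icc t₀ t₁))
    (hd : ∀ t ∈ Set.Ioo t₀ t₁, HasDerivAt ξ (a t *ᵥ ξ t) t)
    (hD : ∀ t ∈ Set.Ioo t₀ t₁, ∀ i j, |a t i j| ≤ D)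
    (hoff : ∀ t ∈ Set.Ioo t₀ t₁, ∀ i j, i ≠ j → 0 ≤ a t i j)
    (h0 : 0 ≤ ξ t₀) : 0 ≤ ξ t₁ := by
  -- W measures the distance to the orthant; the goal is W' ≤ C W with W(t₀) = 0, as in Grönwall's
  -- inequality.
  set W : ℝ → ℝ := fun t => ∑ i, min (ξ t i) 0 ^ 2 with hW
  have hWc : ContinuousOn W (Set.Icc t₀ t₁) := by
    refine continuousOn_finsetSum _ fun i _ => ContinuousOn.pow ?_ 2
    exact (((continuous_apply i).comp_continuousOn hc)).inf continuousOn_const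
  have hWd : ∀ t ∈ Set.Ioo t₀ t₁,
      HasDerivAt W (∑ i, 2 * min (ξ t i) 0 * (a t *ᵥ ξ t) i) t := by
    intro t ht
    refine HasDerivAt.fun_sum fun i _ => ?_
    exact (hasDerivAt_min_zero_sq (ξ t i)).comp t ((hasDerivAt_pi.1 (hd t ht)) i)
  set C : ℝ := 2 * (D * n) with hC
  have hbound : ∀ t ∈ Set.Ioo t₀ t₁,
      (∑ i, 2 * min (ξ t i) 0 * (a t *ᵥ ξ t) i) ≤ C * W t := by
    intro t ht
    have h1 : ∀ i j, min (ξ t i) 0 * (a t i j * ξ t j) ≤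
        D * ((min (ξ t i) 0 ^ 2 + min (ξ t j) 0 ^ 2) / 2) := by
      intro i j
      have hi : min (ξ t i) 0 ≤ 0 := min_le_right _ _
      have hj : min (ξ t j) 0 ≤ 0 := min_le_right _ _
      have hj' : min (ξ t j) 0 ≤ ξ t j := min_le_left _ _
      have hD' := abs_le.1 (hD t ht i j)
      -- Off the diagonal, the positive part of ξ_j only helps, since a_ij ≥ 0 and the first factor
      -- is nonpositive.
      have h2 : min (ξ t i) 0 * (a t i j * ξ t j) ≤
          a t i j * (min (ξ t i) 0 * min (ξ t j) 0) := by
        by_cases hij : i = j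
        · subst hij
          rcases le_total (ξ t i) 0 with h | h
          · rw [min_eq_left h]
            exact le_of_eq (by ring)
          · rw [min_eq_right h]
            simp
        · have := hoff t ht i j hij
          nlinarith [mul_nonneg this (mul_nonneg (neg_nonneg.2 hi) (sub_nonneg.2 hj'))]
      have h3 : 0 ≤ min (ξ t i) 0 * min (ξ t j) 0 := mul_nonneg_of_nonpos_of_nonpos hi hj
      have h4 : 0 ≤ D := (abs_nonneg _).trans (hD t ht i j)
      refine h2.trans ((mul_le_mul_of_nonneg_right hD'.2 h3).trans
        (mul_le_mul_of_nonneg_left ?_ h4))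
      nlinarith [sq_nonneg (min (ξ t i) 0 - min (ξ t j) 0)]
    calc (∑ i, 2 * min (ξ t i) 0 * (a t *ᵥ ξ t) i)
        = ∑ i, ∑ j, 2 * (min (ξ t i) 0 * (a t i j * ξ t j)) := by
          refine Finset.sum_congr rfl fun i _ => ?_
          rw [Matrix.mulVec, dotProduct, Finset.mul_sum]
          exact Finset.sum_congr rfl fun j _ => by ring
      _ ≤ ∑ i : Fin n, ∑ j : Fin n, D * (min (ξ t i) 0 ^ 2 + min (ξ t j) 0 ^ 2) := by
          refine Finset.sum_le_sum fun i _ => Finset.sum_le_sum fun j _ => ?_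
          linarith [h1 i j]
      _ = C * W t := by
          simp only [← Finset.mul_sum, Finset.sum_add_distrib, Finset.sum_const, Finset.card_univ,
            Fintype.card_fin, nsmul_eq_mul, hC, hW]
          ring
  have hanti : AntitoneOn (fun t => Real.exp (-C * t) * W t) (Set.Icc t₀ t₁) := by
    have hder : ∀ t ∈ Set.Ioo t₀ t₁, HasDerivAt (fun t => Real.exp (-C * t) * W t)
        (Real.exp (-C * t) * (-C) * W t +
          Real.exp (-C * t) * ∑ i, 2 * min (ξ t i) 0 * (a t *ᵥ ξ t) i) t := by
      intro t ht
      have h1 : HasDerivAt (fun t => Real.exp (-C * t)) (Real.exp (-C * t) * (-C)) t := by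
        simpa using ((hasDerivAt_id t).const_mul (-C)).exp
      exact h1.mul (hWd t ht)
    refine antitoneOn_of_deriv_nonpos (convex_Icc _ _) ?_ ?_ ?_
    · exact ContinuousOn.mul (by fun_prop) hWc
    · rw [interior_Icc]
      exact fun t ht => (hder t ht).differentiableAt.differentiableWithinAt
    · rw [interior_Icc]
      intro t ht
      rw [(hder t ht).deriv]
      nlinarith [hbound t ht, Real.exp_pos (-C * t)]
  have hW0 : W t₀ = 0 := by
    refine Finset.sum_eq_zero fun i _ => ?_
    have : min (ξ t₀ i) 0 = 0 := min_eq_right (h0 i)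
    simp [this]
  have hW1 : W t₁ ≤ 0 := by
    have := hanti (Set.left_mem_Icc.2 ht) (Set.right_mem_Icc.2 ht) ht
    simp only [hW0, mul_zero] at this
    exact nonpos_of_mul_nonpos_right this (Real.exp_pos _)
  intro i
  have h5 : min (ξ t₁ i) 0 ^ 2 ≤ W t₁ :=
    Finset.single_le_sum (f := fun i => min (ξ t₁ i) 0 ^ 2) (fun j _ => sq_nonneg _)
      (Finset.mem_univ i)
  have h6 : min (ξ t₁ i) 0 = 0 := by
    have : min (ξ t₁ i) 0 ^ 2 ≤ 0 := h5.trans hW1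
    nlinarith [sq_nonneg (min (ξ t₁ i) 0)]
  exact min_eq_right_iff.1 h6

/-! ### Quadratic forms -/

/-- The quadratic form `zᵀ Q z`. -/
def quad {n : ℕ} (Q : Matrix (Fin n) (Fin n) ℝ) (z : Fin n → ℝ) : ℝ := z ⬝ᵥ (Q *ᵥ z)

lemma quad_pos {n : ℕ} {Q : Matrix (Fin n) (Fin n) ℝ} (hQ : Q.PosDef) {z : Fin n → ℝ}
    (hz : z ≠ 0) : 0 < quad Q z := by
  have h := hQ.dotProduct_mulVec_pos hz
  rwa [star_trivial] at h

lemma quad_smul {n : ℕ} (Q : Matrix (Fin n) (Fin n) ℝ) (c : ℝ) (z : Fin n → ℝ) :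
    quad Q (c • z) = c ^ 2 * quad Q z := by
  simp only [quad, Matrix.mulVec_smul, smul_dotProduct, dotProduct_smul, smul_eq_mul]
  ring

lemma quad_zero {n : ℕ} (Q : Matrix (Fin n) (Fin n) ℝ) : quad Q 0 = 0 := by simp [quad]

lemma quad_neg {n : ℕ} (Q : Matrix (Fin n) (Fin n) ℝ) (z : Fin n → ℝ) :
    quad Q (-z) = quad Q z := by
  simp [quad, Matrix.mulVec_neg]

lemma contDiff_quad {n : ℕ} (Q : Matrix (Fin n) (Fin n) ℝ) {m : WithTop ℕ∞} :
    ContDiff ℝ m (quad Q) := by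
  unfold quad Matrix.mulVec dotProduct
  fun_prop

lemma continuous_quad {n : ℕ} (Q : Matrix (Fin n) (Fin n) ℝ) : Continuous (quad Q) :=
  (contDiff_quad Q (m := 0)).continuous

lemma eq_norm_smul_unit {n : ℕ} (z : Fin n → ℝ) (hz : z ≠ 0) :
    ∃ u ∈ Metric.sphere (0 : Fin n → ℝ) 1, z = ‖z‖ • u := by
  have h : ‖z‖ ≠ 0 := norm_ne_zero_iff.2 hz
  refine ⟨‖z‖⁻¹ • z, ?_, ?_⟩
  · simp [norm_smul, h]
  · rw [smul_smul, mul_inv_cancel₀ h, one_smul]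

lemma exists_quad_le {n : ℕ} (Q : Matrix (Fin n) (Fin n) ℝ) :
    ∃ C > 0, ∀ z, quad Q z ≤ C * ‖z‖ ^ 2 := by
  obtain ⟨C, hC⟩ := (isCompact_sphere (0 : Fin n → ℝ) 1).bddAbove_image
    (continuous_quad Q).continuousOn
  refine ⟨max C 1, by positivity, fun z => ?_⟩
  by_cases hz : z = 0
  · simp [hz, quad_zero]
  · obtain ⟨u, hu, hzu⟩ := eq_norm_smul_unit z hz
    have h1 : quad Q z = ‖z‖ ^ 2 * quad Q u := by
      conv_lhs => rw [hzu]
      exact quad_smul _ _ _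
    have h2 : quad Q u ≤ max C 1 := (hC ⟨u, hu, rfl⟩).trans (le_max_left _ _)
    rw [h1, mul_comm]
    gcongr

lemma exists_le_quad {n : ℕ} {Q : Matrix (Fin n) (Fin n) ℝ} (hQ : Q.PosDef) :
    ∃ c > 0, ∀ z, c * ‖z‖ ^ 2 ≤ quad Q z := by
  rcases (Metric.sphere (0 : Fin n → ℝ) 1).eq_empty_or_nonempty with he | hne
  -- The unit sphere is empty for n = 0.
  · refine ⟨1, one_pos, fun z => ?_⟩
    by_cases hz : z = 0
    · simp [hz, quad_zero]
    · obtain ⟨u, hu, -⟩ := eq_norm_smul_unit z hz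
      simp [he] at hu
  · obtain ⟨u₀, hu₀, hmin⟩ := (isCompact_sphere (0 : Fin n → ℝ) 1).exists_isMinOn hne
      (continuous_quad Q).continuousOn
    have hu₀' : u₀ ≠ 0 := by
      rintro rfl
      simp at hu₀
    refine ⟨quad Q u₀, quad_pos hQ hu₀', fun z => ?_⟩
    by_cases hz : z = 0
    · simp [hz, quad_zero]
    · obtain ⟨u, hu, hzu⟩ := eq_norm_smul_unit z hz
      have h1 : quad Q z = ‖z‖ ^ 2 * quad Q u := by
        conv_lhs => rw [hzu]
        exact quad_smul _ _ _
      rw [h1, mul_comm]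
      have := hmin hu
      gcongr
      exact this

lemma exists_quad_le_quad {n : ℕ} {Q : Matrix (Fin n) (Fin n) ℝ} (hQ : Q.PosDef)
    (P : Matrix (Fin n) (Fin n) ℝ) : ∃ c > 0, ∀ z, c * quad P z ≤ quad Q z := by
  obtain ⟨c, hc, h1⟩ := exists_le_quad hQ
  obtain ⟨C, hC, h2⟩ := exists_quad_le P
  refine ⟨c / C, by positivity, fun z => le_trans ?_ (h1 z)⟩
  rw [div_mul_eq_mul_div, div_le_iff₀ hC]
  nlinarith [h2 z]

lemma HasDerivAt.quad {n : ℕ} (Q : Matrix (Fin n) (Fin n) ℝ) {x : ℝ → Fin n → ℝ}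
    {x' : Fin n → ℝ} {t : ℝ} (hx : HasDerivAt x x' t) :
    HasDerivAt (fun t => quad Q (x t)) (x' ⬝ᵥ (Q *ᵥ x t) + x t ⬝ᵥ (Q *ᵥ x')) t := by
  have hx' := hasDerivAt_pi.1 hx
  have h1 : ∀ i, HasDerivAt (fun t => x t i * (Q *ᵥ x t) i)
      (x' i * (Q *ᵥ x t) i + x t i * (Q *ᵥ x') i) t := by
    intro i
    refine (hx' i).fun_mul ?_
    simp only [Matrix.mulVec, dotProduct]
    exact HasDerivAt.fun_sum fun j _ => (hx' j).const_mul _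
  have := HasDerivAt.fun_sum (u := Finset.univ) fun i _ => h1 i
  simpa only [NonOvershoot.quad, dotProduct, Finset.sum_add_distrib] using this

/-- Turns the derivative of zᵀQz along z' = M z into the form occurring in the matrix inequalities.
-/
lemma quad_lyapunov {n : ℕ} (Q M : Matrix (Fin n) (Fin n) ℝ) (z : Fin n → ℝ) :
    (M *ᵥ z) ⬝ᵥ (Q *ᵥ z) + z ⬝ᵥ (Q *ᵥ (M *ᵥ z)) = quad (Q * M + Mᵀ * Q) z := by
  rw [quad, Matrix.add_mulVec, dotProduct_add, ← Matrix.mulVec_mulVec, ← Matrix.mulVec_mulVec,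
    add_comm]
  congr 1
  rw [Matrix.dotProduct_mulVec z Mᵀ, Matrix.vecMul_transpose]

lemma generator_transpose (n : ℕ) (μ : ℝ) : (generator n μ)ᵀ = generator n μ :=
  Matrix.diagonal_transpose _

lemma pNorm_eq_one_iff {n : ℕ} {P : Matrix (Fin n) (Fin n) ℝ} {z : Fin n → ℝ} :
    pNorm P z = 1 ↔ quad P z = 1 := by
  rw [pNorm, Real.sqrt_eq_one, quad]

/-! ### The canonical homogeneous norm -/

lemma hasDerivAt_dil_mulVec {n : ℕ} (μ : ℝ) {s : ℝ → ℝ} {x : ℝ → Fin n → ℝ} {s' : ℝ}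
    {x' : Fin n → ℝ} {t : ℝ} (hs : HasDerivAt s s' t) (hx : HasDerivAt x x' t) :
    HasDerivAt (fun t => dil n μ (s t) *ᵥ x t)
      (dil n μ (s t) *ᵥ x' + s' • (generator n μ *ᵥ (dil n μ (s t) *ᵥ x t))) t := by
  rw [hasDerivAt_pi]
  intro k
  have h1 : HasDerivAt (fun t => Real.exp (s t * dilWeight n μ k))
      (Real.exp (s t * dilWeight n μ k) * (s' * dilWeight n μ k)) t := (hs.mul_const _).exp
  have h2 := h1.fun_mul (hasDerivAt_pi.1 hx k)
  simp only [dil_mulVec_apply, Pi.add_apply, Pi.smul_apply, generator_mulVec_apply, smul_eq_mul]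
  exact h2.congr_deriv (by ring)

lemma contDiff_dil_mulVec (n : ℕ) (μ : ℝ) {m : WithTop ℕ∞} :
    ContDiff ℝ m fun q : (Fin n → ℝ) × ℝ => dil n μ q.2 *ᵥ q.1 := by
  rw [contDiff_pi]
  intro k
  simp only [dil_mulVec_apply]
  fun_prop

/-- The hypotheses under which the canonical homogeneous norm is well defined and smooth: `P` is
positive definite and the dilation is monotone with respect to `‖·‖_P`. -/
structure IsMonotoneDilation {n : ℕ} (μ : ℝ) (P : Matrix (Fin n) (Fin n) ℝ) : Prop where
  posDef : P.PosDef
  posDef_gen : (P * generator n μ + generator n μ * P).PosDef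

/-- The logarithm of the canonical homogeneous norm. -/
noncomputable def homLog {n : ℕ} (μ : ℝ) (P : Matrix (Fin n) (Fin n) ℝ) (z : Fin n → ℝ) : ℝ :=
  Real.log (homNorm μ P z)

lemma homProj_eq {n : ℕ} (μ : ℝ) (P : Matrix (Fin n) (Fin n) ℝ) (z : Fin n → ℝ) :
    homProj μ P z = dil n μ (-homLog μ P z) *ᵥ z := rfl

namespace IsMonotoneDilation

variable {n : ℕ} {μ : ℝ} {P : Matrix (Fin n) (Fin n) ℝ}

lemma hasDerivAt_quad_dil (z : Fin n → ℝ) (s : ℝ) :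
    HasDerivAt (fun s => quad P (dil n μ (-s) *ᵥ z))
      (-quad (P * generator n μ + generator n μ * P) (dil n μ (-s) *ᵥ z)) s := by
  have h := HasDerivAt.quad P
    (hasDerivAt_dil_mulVec μ (hasDerivAt_neg s) (hasDerivAt_const s z))
  convert h using 1
  have h2 := quad_lyapunov P (generator n μ) (dil n μ (-s) *ᵥ z)
  rw [generator_transpose] at h2
  rw [← h2]
  simp only [Matrix.mulVec_zero, zero_add, neg_smul, one_smul, Matrix.mulVec_neg, neg_dotProduct,
    dotProduct_neg]
  ring

/-- Comparing P G + G P with P gives decay at an exponential rate, which is what forces s ↦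
‖d(-s)z‖_P to cross the level 1. -/
lemma exists_antitone_exp_mul_quad (h : IsMonotoneDilation μ P) :
    ∃ c > 0, ∀ z, Antitone fun s => Real.exp (c * s) * quad P (dil n μ (-s) *ᵥ z) := by
  obtain ⟨c, hc, hle⟩ := exists_quad_le_quad h.posDef_gen P
  refine ⟨c, hc, fun z => ?_⟩
  have hd : ∀ s, HasDerivAt (fun s => Real.exp (c * s) * quad P (dil n μ (-s) *ᵥ z))
      (Real.exp (c * s) * c * quad P (dil n μ (-s) *ᵥ z) + Real.exp (c * s) *
        (-quad (P * generator n μ + generator n μ * P) (dil n μ (-s) *ᵥ z))) s := by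
    intro s
    have h1 : HasDerivAt (fun s => Real.exp (c * s)) (Real.exp (c * s) * c) s := by
      simpa using ((hasDerivAt_id s).const_mul c).exp
    exact h1.fun_mul (hasDerivAt_quad_dil z s)
  refine antitone_of_deriv_nonpos (fun s => (hd s).differentiableAt) fun s => ?_
  rw [(hd s).deriv]
  nlinarith [hle (dil n μ (-s) *ᵥ z), Real.exp_pos (c * s)]

lemma strictAnti_quad_dil (h : IsMonotoneDilation μ P) {z : Fin n → ℝ} (hz : z ≠ 0) :
    StrictAnti fun s => quad P (dil n μ (-s) *ᵥ z) := by
  refine strictAnti_of_deriv_neg fun s => ?_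
  rw [(hasDerivAt_quad_dil z s).deriv, neg_lt_zero]
  exact quad_pos h.posDef_gen (dil_mulVec_eq_zero.not.2 hz)

lemma existsUnique_pNorm (h : IsMonotoneDilation μ P) {z : Fin n → ℝ} (hz : z ≠ 0) :
    ∃! s : ℝ, pNorm P (dil n μ (-s) *ᵥ z) = 1 := by
  simp only [pNorm_eq_one_iff]
  have hanti := h.strictAnti_quad_dil hz
  have hcont : Continuous fun s => quad P (dil n μ (-s) *ᵥ z) :=
    continuous_iff_continuousAt.2 fun s => (hasDerivAt_quad_dil z s).continuousAt
  obtain ⟨c, hc, hA⟩ := h.exists_antitone_exp_mul_quad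
  set p : ℝ := quad P z with hp
  have hp0 : 0 < p := quad_pos h.posDef hz
  have hzero : quad P (dil n μ (-0) *ᵥ z) = p := by rw [neg_zero, dil_zero_mulVec]
  obtain ⟨s₁, h1⟩ : ∃ s, 1 ≤ quad P (dil n μ (-s) *ᵥ z) := by
    -- For s ≤ 0 the monotone quantity is at least p, its value at 0; choosing also e^{cs} ≤ p
    -- leaves the quadratic form at least 1. The point s₂ below is the mirror image.
    have h3 := hA z (min_le_left (0 : ℝ) (Real.log p / c))
    have h4 := hA z (min_le_right (0 : ℝ) (Real.log p / c))
    simp only [hzero, mul_zero, Real.exp_zero, one_mul] at h3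
    refine ⟨min 0 (Real.log p / c), ?_⟩
    have h5 : Real.exp (c * min 0 (Real.log p / c)) ≤ p := by
      rw [← Real.le_log_iff_exp_le hp0, mul_comm, ← le_div_iff₀ hc]
      exact min_le_right _ _
    have h6 := Real.exp_pos (c * min 0 (Real.log p / c))
    by_contra hlt
    push Not at hlt
    nlinarith
  obtain ⟨s₂, h2⟩ : ∃ s, quad P (dil n μ (-s) *ᵥ z) ≤ 1 := by
    have h3 := hA z (le_max_left (0 : ℝ) (Real.log p / c))
    simp only [hzero, mul_zero, Real.exp_zero, one_mul] at h3
    refine ⟨max 0 (Real.log p / c), ?_⟩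
    have h5 : p ≤ Real.exp (c * max 0 (Real.log p / c)) := by
      rw [← Real.log_le_iff_le_exp hp0, mul_comm, ← div_le_iff₀ hc]
      exact le_max_right _ _
    have h6 := Real.exp_pos (c * max 0 (Real.log p / c))
    by_contra hlt
    push Not at hlt
    nlinarith
  obtain ⟨s, hs⟩ := mem_range_of_exists_le_of_exists_ge hcont ⟨s₂, h2⟩ ⟨s₁, h1⟩
  exact ⟨s, hs, fun s' hs' => hanti.injective (by simpa using hs'.trans hs.symm)⟩

lemma homNorm_pos {z : Fin n → ℝ} (hz : z ≠ 0) : 0 < homNorm μ P z := by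
  rw [homNorm, if_neg hz]
  exact Real.exp_pos _

lemma homNorm_eq_exp {z : Fin n → ℝ} (hz : z ≠ 0) : homNorm μ P z = Real.exp (homLog μ P z) := by
  rw [homLog, Real.exp_log (homNorm_pos hz)]

lemma homNorm_zero : homNorm μ P (0 : Fin n → ℝ) = 0 := by simp [homNorm]

lemma homProj_zero : homProj μ P (0 : Fin n → ℝ) = 0 := by simp [homProj]

lemma quad_homProj (h : IsMonotoneDilation μ P) {z : Fin n → ℝ} (hz : z ≠ 0) :
    quad P (homProj μ P z) = 1 := by
  rw [← pNorm_eq_one_iff, homProj, homNorm, if_neg hz, Real.log_exp]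
  exact Classical.epsilon_spec (p := fun s : ℝ => pNorm P (dil n μ (-s) *ᵥ z) = 1)
    (h.existsUnique_pNorm hz).exists

lemma homLog_eq (h : IsMonotoneDilation μ P) {z : Fin n → ℝ} {s : ℝ}
    (hs : quad P (dil n μ (-s) *ᵥ z) = 1) : homLog μ P z = s := by
  have hz : z ≠ 0 := by
    rintro rfl
    simp [quad_zero] at hs
  exact (h.strictAnti_quad_dil hz).injective ((h.quad_homProj hz).trans hs.symm)

lemma homLog_dil (h : IsMonotoneDilation μ P) {z : Fin n → ℝ} (hz : z ≠ 0) (s : ℝ) :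
    homLog μ P (dil n μ s *ᵥ z) = s + homLog μ P z := by
  refine h.homLog_eq ?_
  rw [← dil_add_mulVec, show -(s + homLog μ P z) + s = -homLog μ P z by ring]
  exact h.quad_homProj hz

lemma homProj_dil (h : IsMonotoneDilation μ P) (z : Fin n → ℝ) (s : ℝ) :
    homProj μ P (dil n μ s *ᵥ z) = homProj μ P z := by
  by_cases hz : z = 0
  · simp [hz]
  · rw [homProj_eq, homProj_eq, h.homLog_dil hz, ← dil_add_mulVec]
    congr 2
    ring

lemma homLog_neg (h : IsMonotoneDilation μ P) (z : Fin n → ℝ) :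
    homLog μ P (-z) = homLog μ P z := by
  by_cases hz : z = 0
  · simp [hz]
  · refine h.homLog_eq ?_
    rw [Matrix.mulVec_neg, quad_neg]
    exact h.quad_homProj hz

lemma homNorm_neg (h : IsMonotoneDilation μ P) (z : Fin n → ℝ) :
    homNorm μ P (-z) = homNorm μ P z := by
  by_cases hz : z = 0
  · simp [hz]
  · rw [homNorm_eq_exp hz, homNorm_eq_exp (neg_ne_zero.2 hz), h.homLog_neg]

lemma homProj_neg (h : IsMonotoneDilation μ P) (z : Fin n → ℝ) :
    homProj μ P (-z) = -homProj μ P z := by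
  rw [homProj_eq, homProj_eq, h.homLog_neg, Matrix.mulVec_neg]

lemma dil_homLog_homProj (z : Fin n → ℝ) : dil n μ (homLog μ P z) *ᵥ homProj μ P z = z := by
  rw [homProj_eq, ← dil_add_mulVec, add_neg_cancel, dil_zero_mulVec]

lemma homLog_le_iff (h : IsMonotoneDilation μ P) {z : Fin n → ℝ} (hz : z ≠ 0) {s : ℝ} :
    homLog μ P z ≤ s ↔ quad P (dil n μ (-s) *ᵥ z) ≤ 1 := by
  rw [← h.quad_homProj hz]
  exact (h.strictAnti_quad_dil hz).le_iff_ge.symm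

/-- Implicit function theorem for quad P (d(-s) z) = 1: the s-derivative is nonzero by monotonicity
of the dilation, and uniqueness of s identifies the implicit function with `homLog`. -/
lemma contDiffAt_homLog (h : IsMonotoneDilation μ P) {z : Fin n → ℝ} (hz : z ≠ 0) :
    ContDiffAt ℝ 1 (homLog μ P) z := by
  set F : (Fin n → ℝ) × ℝ → ℝ := fun q => quad P (dil n μ (-q.2) *ᵥ q.1) with hF
  set u : (Fin n → ℝ) × ℝ := (z, homLog μ P z) with hu
  have hFc : ContDiff ℝ 1 F := (contDiff_quad P).comp
    ((contDiff_dil_mulVec n μ).comp (contDiff_fst.prodMk contDiff_snd.neg))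
  have cdf : ContDiffAt ℝ 1 F u := hFc.contDiffAt
  have hFu : F u = 1 := h.quad_homProj hz
  have hder : (fderiv ℝ F u ∘L .inr ℝ (Fin n → ℝ) ℝ) 1 ≠ 0 := by
    have h1 : HasFDerivAt F (fderiv ℝ F u) u := (hFc.differentiable one_ne_zero u).hasFDerivAt
    have h2 : HasDerivAt (fun s : ℝ => ((z, s) : (Fin n → ℝ) × ℝ)) (0, 1) (homLog μ P z) :=
      (hasDerivAt_const _ z).prodMk (hasDerivAt_id _)
    have h3 := h1.comp_hasDerivAt (homLog μ P z) h2
    have h4 := h3.unique (hasDerivAt_quad_dil (μ := μ) (P := P) z (homLog μ P z))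
    simp only [ContinuousLinearMap.comp_apply, ContinuousLinearMap.inr_apply]
    rw [h4]
    exact (neg_lt_zero.2 (quad_pos h.posDef_gen (dil_mulVec_eq_zero.not.2 hz))).ne
  have hinv : (fderiv ℝ F u ∘L .inr ℝ (Fin n → ℝ) ℝ).IsInvertible := by
    refine ⟨ContinuousLinearEquiv.smulLeft (Units.mk0 _ hder), ?_⟩
    ext
    simp
  have h1 := cdf.contDiffAt_implicitFunction one_ne_zero hinv
  refine h1.congr_of_eventuallyEq ?_
  filter_upwards [cdf.eventually_apply_implicitFunction one_ne_zero hinv] with w hw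
  exact h.homLog_eq (hw.trans hFu)

lemma continuousOn_homLog (h : IsMonotoneDilation μ P) :
    ContinuousOn (homLog μ P) {0}ᶜ :=
  fun _ hz => (h.contDiffAt_homLog hz).continuousAt.continuousWithinAt

lemma continuousOn_homProj (h : IsMonotoneDilation μ P) :
    ContinuousOn (homProj μ P) {0}ᶜ :=
  (contDiff_dil_mulVec n μ (m := 0)).continuous.comp_continuousOn
    (continuousOn_id.prodMk h.continuousOn_homLog.neg)

lemma exists_norm_homProj_le (h : IsMonotoneDilation μ P) :
    ∃ C > 0, ∀ z, ‖homProj μ P z‖ ≤ C := by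
  obtain ⟨c, hc, hle⟩ := exists_le_quad h.posDef
  refine ⟨1 / c + 1, by positivity, fun z => ?_⟩
  by_cases hz : z = 0
  · rw [hz, homProj_zero, norm_zero]
    positivity
  · have h1 := hle (homProj μ P z)
    rw [h.quad_homProj hz] at h1
    have h2 : ‖homProj μ P z‖ ^ 2 ≤ 1 / c := by rwa [le_div_iff₀' hc]
    nlinarith [sq_nonneg (‖homProj μ P z‖ - 1)]

lemma continuous_homNorm (h : IsMonotoneDilation μ P) : Continuous (homNorm μ P) := by
  refine continuous_iff_continuousAt.2 fun z => ?_
  by_cases hz : z = 0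
  · subst hz
    rw [ContinuousAt, homNorm_zero, Metric.tendsto_nhds]
    intro ε hε
    -- By `homLog_le_iff`, ‖z‖_d ≤ ε/2 follows from a bound on a fixed quadratic form in z, which
    -- holds near 0.
    have hc : Continuous fun z => quad P (dil n μ (-Real.log (ε / 2)) *ᵥ z) :=
      (continuous_quad P).comp (continuous_const.matrix_mulVec continuous_id)
    have hlt : ∀ᶠ z in nhds (0 : Fin n → ℝ), quad P (dil n μ (-Real.log (ε / 2)) *ᵥ z) < 1 :=
      hc.continuousAt.eventually_lt_const (by simp [quad_zero])
    filter_upwards [hlt] with z hz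
    by_cases h0 : z = 0
    · simpa [h0, homNorm_zero] using hε
    · have h1 := (h.homLog_le_iff h0).2 hz.le
      rw [Real.dist_eq, sub_zero, abs_of_pos (homNorm_pos h0), homNorm_eq_exp h0]
      have h2 := Real.exp_le_exp.2 h1
      rw [Real.exp_log (by positivity)] at h2
      linarith
  · have h1 : ContinuousAt (fun z => Real.exp (homLog μ P z)) z :=
      (h.contDiffAt_homLog hz).continuousAt.rexp
    refine h1.congr ?_
    filter_upwards [isOpen_compl_singleton.mem_nhds hz] with w hw
    exact (homNorm_eq_exp hw).symm

lemma homNorm_nonneg (z : Fin n → ℝ) : 0 ≤ homNorm μ P z := by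
  by_cases hz : z = 0
  · rw [hz, homNorm_zero]
  · exact (homNorm_pos hz).le

/-- All weights are at least 1 when μ ≤ 0, so contraction is at least as strong as e^s. -/
lemma norm_dil_mulVec_le (hμ : μ ≤ 0) {s : ℝ} (hs : s ≤ 0) (z : Fin n → ℝ) :
    ‖dil n μ s *ᵥ z‖ ≤ Real.exp s * ‖z‖ := by
  refine (pi_norm_le_iff_of_nonneg (by positivity)).2 fun k => ?_
  rw [dil_mulVec_apply, norm_mul, Real.norm_of_nonneg (Real.exp_pos _).le]
  gcongr
  · nlinarith [one_le_dilWeight hμ k]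
  · exact norm_le_pi_norm z k

lemma exists_norm_le_homNorm (h : IsMonotoneDilation μ P) (hμ : μ ≤ 0) :
    ∃ C > 0, ∀ z, homNorm μ P z ≤ 1 → ‖z‖ ≤ C * homNorm μ P z := by
  obtain ⟨C, hC, hle⟩ := h.exists_norm_homProj_le
  refine ⟨C, hC, fun z hz1 => ?_⟩
  by_cases hz : z = 0
  · simp [hz, homNorm_zero]
  · have h1 : homLog μ P z ≤ 0 := Real.log_nonpos (homNorm_nonneg z) hz1
    have h2 := norm_dil_mulVec_le hμ h1 (homProj μ P z)
    rw [dil_homLog_homProj, ← homNorm_eq_exp hz] at h2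
    rw [mul_comm]
    exact h2.trans (mul_le_mul_of_nonneg_left (hle z) (homNorm_nonneg z))

end IsMonotoneDilation

/-! ### The closed loop of a single agent -/

/-- The closed-loop vector field `z ↦ A z - ‖z‖_d ^ (1 + μ) K_lin d(-ln ‖z‖_d) z B`. -/
noncomputable def agentField {n : ℕ} (μ lam : ℝ) (P : Matrix (Fin n) (Fin n) ℝ)
    (z : Fin n → ℝ) : Fin n → ℝ :=
  chainA n *ᵥ z + protocol μ lam P z • inputB n

/-- The standing assumptions on the homogeneous closed loop. -/
structure IsHomogeneousLoop {n : ℕ} (μ lam : ℝ) (P : Matrix (Fin n) (Fin n) ℝ) : Prop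
    extends IsMonotoneDilation μ P where
  degree_ge : -1 ≤ μ
  degree_neg : μ < 0
  lam_pos : 0 < lam
  lyapunov : (-(P * closedLoopMatrix n lam + (closedLoopMatrix n lam)ᵀ * P)).PosDef

/-- The quotient `yᵀ (P M + Mᵀ P) y / yᵀ (P G_d + G_d P) y` with `M = A - B K_lin`: the decay rate
of `ln ‖·‖_d` on the unit sphere. -/
noncomputable def decayRate {n : ℕ} (μ lam : ℝ) (P : Matrix (Fin n) (Fin n) ℝ)
    (y : Fin n → ℝ) : ℝ :=
  quad (P * closedLoopMatrix n lam + (closedLoopMatrix n lam)ᵀ * P) y /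
    quad (P * generator n μ + generator n μ * P) y

/-- The behaviour of one error component along a solution of the network. -/
structure IsAgentSolution {n : ℕ} (μ lam : ℝ) (P : Matrix (Fin n) (Fin n) ℝ) (τ : ℝ)
    (x : ℝ → Fin n → ℝ) : Prop where
  continuousOn : ContinuousOn x (Set.Icc 0 τ)
  hasDerivAt : ∀ t ∈ Set.Ioo 0 τ, x t ≠ 0 → HasDerivAt x (agentField μ lam P (x t)) t

lemma quad_neg_left {n : ℕ} (Q : Matrix (Fin n) (Fin n) ℝ) (z : Fin n → ℝ) :
    quad (-Q) z = -quad Q z := by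
  simp [quad, Matrix.neg_mulVec]

namespace IsHomogeneousLoop

open IsMonotoneDilation

variable {n : ℕ} {μ lam : ℝ} {P : Matrix (Fin n) (Fin n) ℝ}

/-- Homogeneity of degree μ reduces the field to the linear closed loop on the unit sphere. -/
lemma agentField_eq {z : Fin n → ℝ} (hz : z ≠ 0) :
    agentField μ lam P z = Real.exp (μ * homLog μ P z) •
      dil n μ (homLog μ P z) *ᵥ (closedLoopMatrix n lam *ᵥ homProj μ P z) := by
  have h1 : chainA n *ᵥ z = Real.exp (μ * homLog μ P z) •
      dil n μ (homLog μ P z) *ᵥ (chainA n *ᵥ homProj μ P z) := by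
    rw [← chainA_mulVec_dil, dil_homLog_homProj]
  rw [agentField, protocol, h1, closedLoopMatrix_mulVec, Matrix.mulVec_sub, Matrix.mulVec_smul,
    dil_mulVec_inputB, smul_sub, smul_smul, smul_smul, sub_eq_add_neg, ← neg_smul,
    homNorm_eq_exp hz, ← Real.exp_mul]
  congr 2
  rw [show homLog μ P z * (1 + μ) = μ * homLog μ P z + homLog μ P z by ring, Real.exp_add]
  ring

lemma protocol_neg (h : IsMonotoneDilation μ P) (z : Fin n → ℝ) :
    protocol μ lam P (-z) = -protocol μ lam P z := by
  simp [protocol, h.homNorm_neg, h.homProj_neg]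

lemma agentField_neg (h : IsMonotoneDilation μ P) (z : Fin n → ℝ) :
    agentField μ lam P (-z) = -agentField μ lam P z := by
  rw [agentField, agentField, protocol_neg h, Matrix.mulVec_neg, neg_smul, neg_add]

lemma agentField_zero : agentField μ lam P (0 : Fin n → ℝ) = 0 := by
  simp [agentField, protocol, homProj_zero]

lemma continuousOn_agentField (h : IsMonotoneDilation μ P) :
    ContinuousOn (agentField μ lam P) {0}ᶜ := by
  have h1 : Continuous fun y : Fin n → ℝ => gainLin n lam ⬝ᵥ y :=
    continuous_const.dotProduct continuous_id
  have h2 : ContinuousOn (fun z => homNorm μ P z ^ (1 + μ)) {0}ᶜ :=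
    h.continuous_homNorm.continuousOn.rpow_const fun z hz => Or.inl (homNorm_pos hz).ne'
  have h3 : ContinuousOn (protocol μ lam P) {0}ᶜ :=
    (h2.mul (h1.comp_continuousOn h.continuousOn_homProj)).neg
  exact (continuous_const.matrix_mulVec continuous_id).continuousOn.add
    (h3.smul continuousOn_const)

/-- Supplies the bound that makes the field integrable along trajectories, also where it is
discontinuous. -/
lemma exists_norm_agentField_le (h : IsMonotoneDilation μ P) :
    ∃ C > 0, ∀ z, ‖agentField μ lam P z‖ ≤ C * (‖z‖ + homNorm μ P z ^ (1 + μ)) := by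
  obtain ⟨C, hC, hle⟩ := h.exists_norm_homProj_le
  set L₁ := LinearMap.toContinuousLinearMap (Matrix.mulVecLin (chainA n)) with hL₁
  set L₂ : (Fin n → ℝ) →L[ℝ] (Fin n → ℝ) := LinearMap.toContinuousLinearMap
    (Matrix.mulVecLin (Matrix.vecMulVec (inputB n) (gainLin n lam))) with hL₂
  refine ⟨‖L₁‖ + ‖L₂‖ * C + 1, by positivity, fun z => ?_⟩
  have h0 : agentField μ lam P z = L₁ z - homNorm μ P z ^ (1 + μ) • L₂ (homProj μ P z) := by
    simp only [agentField, protocol, hL₁, hL₂, LinearMap.coe_toContinuousLinearMap',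
      Matrix.mulVecLin_apply, Matrix.vecMulVec_mulVec, neg_smul, sub_eq_add_neg, mul_smul]
    simp
  have h1 : 0 ≤ homNorm μ P z ^ (1 + μ) := Real.rpow_nonneg (homNorm_nonneg z) _
  have h2 : ‖L₂ (homProj μ P z)‖ ≤ ‖L₂‖ * C :=
    (L₂.le_opNorm _).trans (mul_le_mul_of_nonneg_left (hle z) (norm_nonneg _))
  rw [h0]
  refine (norm_sub_le _ _).trans ?_
  rw [norm_smul, Real.norm_of_nonneg h1]
  have h3 := L₁.le_opNorm z
  have h4 := mul_le_mul_of_nonneg_left h2 h1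
  have h5 := norm_nonneg L₁
  have h6 := norm_nonneg L₂
  have h7 := norm_nonneg z
  have h8 : 0 ≤ ‖L₂‖ * C := by positivity
  nlinarith [mul_nonneg h8 h7, mul_nonneg h5 h1]

lemma quad_gen_pos (h : IsMonotoneDilation μ P) {y : Fin n → ℝ} (hy : y ≠ 0) :
    0 < quad (P * generator n μ + generator n μ * P) y := quad_pos h.posDef_gen hy

lemma homProj_ne_zero {z : Fin n → ℝ} (hz : z ≠ 0) : homProj μ P z ≠ 0 :=
  dil_mulVec_eq_zero.not.2 hz

lemma exists_decayRate_le (h : IsHomogeneousLoop μ lam P) :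
    ∃ c > 0, ∀ y ≠ 0, decayRate μ lam P y ≤ -c := by
  obtain ⟨c, hc, hle⟩ := exists_quad_le_quad h.lyapunov
    (P * generator n μ + generator n μ * P)
  refine ⟨c, hc, fun y hy => ?_⟩
  have h1 := hle y
  rw [quad_neg_left] at h1
  rw [decayRate, div_le_iff₀ (quad_gen_pos h.toIsMonotoneDilation hy)]
  linarith

lemma decayRate_neg (h : IsHomogeneousLoop μ lam P) {y : Fin n → ℝ} (hy : y ≠ 0) :
    decayRate μ lam P y < 0 := by
  obtain ⟨c, hc, hle⟩ := h.exists_decayRate_le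
  linarith [hle y hy]

lemma continuousOn_decayRate (h : IsMonotoneDilation μ P) :
    ContinuousOn (decayRate μ lam P) {0}ᶜ :=
  (continuous_quad _).continuousOn.div (continuous_quad _).continuousOn
    fun _ hy => (quad_gen_pos h hy).ne'

lemma dil_neg_agentField {z : Fin n → ℝ} (hz : z ≠ 0) :
    dil n μ (-homLog μ P z) *ᵥ agentField μ lam P z =
      Real.exp (μ * homLog μ P z) • (closedLoopMatrix n lam *ᵥ homProj μ P z) := by
  rw [agentField_eq hz, Matrix.mulVec_smul, ← dil_add_mulVec, neg_add_cancel, dil_zero_mulVec]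

lemma hasDerivAt_homLog (h : IsMonotoneDilation μ P) {x : ℝ → Fin n → ℝ} {t : ℝ}
    (hx : HasDerivAt x (agentField μ lam P (x t)) t) (h0 : x t ≠ 0) :
    HasDerivAt (fun t => homLog μ P (x t))
      (Real.exp (μ * homLog μ P (x t)) * decayRate μ lam P (homProj μ P (x t))) t := by
  have hs := ((h.contDiffAt_homLog h0).differentiableAt one_ne_zero).hasFDerivAt.comp_hasDerivAt
    t hx
  set s' := fderiv ℝ (homLog μ P) (x t) (agentField μ lam P (x t))
  have hy := hasDerivAt_dil_mulVec μ hs.neg hx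
  have hq := HasDerivAt.quad P hy
  -- The projection stays on the unit sphere; differentiating this identity is a linear equation for
  -- the derivative of `homLog`.
  have hone : (fun t => quad P (dil n μ ((-(homLog μ P ∘ x)) t) *ᵥ x t)) =ᶠ[nhds t]
      fun _ => (1 : ℝ) := by
    filter_upwards [hx.continuousAt.eventually_ne h0] with r hr
    exact h.quad_homProj hr
  have hz := (hq.congr_of_eventuallyEq hone.symm).unique (hasDerivAt_const t (1 : ℝ))
  have hy0 := homProj_ne_zero (μ := μ) (P := P) h0
  have e1 : (-(homLog μ P ∘ x)) t = -homLog μ P (x t) := rfl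
  rw [e1, dil_neg_agentField h0, ← homProj_eq] at hz
  have hM := quad_lyapunov P (closedLoopMatrix n lam) (homProj μ P (x t))
  have hG := quad_lyapunov P (generator n μ) (homProj μ P (x t))
  rw [generator_transpose] at hG
  have hb := quad_gen_pos h hy0
  refine hs.congr_deriv ?_
  rw [decayRate, ← mul_div_assoc, eq_div_iff hb.ne', ← hM, ← hG]
  simp only [add_dotProduct, smul_dotProduct, dotProduct_add, Matrix.mulVec_add,
    Matrix.mulVec_smul, dotProduct_smul, smul_eq_mul] at hz
  linear_combination -hz

lemma hasDerivAt_homProj (h : IsMonotoneDilation μ P) {x : ℝ → Fin n → ℝ} {t : ℝ}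
    (hx : HasDerivAt x (agentField μ lam P (x t)) t) (h0 : x t ≠ 0) :
    HasDerivAt (fun t => homProj μ P (x t))
      (Real.exp (μ * homLog μ P (x t)) • (closedLoopMatrix n lam *ᵥ homProj μ P (x t)
        - decayRate μ lam P (homProj μ P (x t)) • (generator n μ *ᵥ homProj μ P (x t)))) t := by
  have h1 := hasDerivAt_dil_mulVec μ (hasDerivAt_homLog h hx h0).neg hx
  refine h1.congr_deriv ?_
  rw [show (-fun t => homLog μ P (x t)) t = -homLog μ P (x t) from rfl,
    dil_neg_agentField h0, ← homProj_eq, neg_smul, smul_sub, smul_smul, sub_eq_add_neg]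

/-- The power `‖x‖_d ^ (-μ)` decreases at least at a constant rate as long as `x ≠ 0`. -/
lemma exists_homNorm_rpow_decrease (h : IsHomogeneousLoop μ lam P) :
    ∃ c > 0, ∀ τ x, IsAgentSolution μ lam P τ x → ∀ a b, 0 ≤ a → a ≤ b → b ≤ τ →
      (∀ t ∈ Set.Ioo a b, x t ≠ 0) →
      homNorm μ P (x b) ^ (-μ) + c * (b - a) ≤ homNorm μ P (x a) ^ (-μ) := by
  obtain ⟨c, hc, hle⟩ := h.exists_decayRate_le
  have hμ := h.degree_neg
  refine ⟨-μ * c, by nlinarith, fun τ x hx a b ha hab hb h0 => ?_⟩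
  have hcont : ContinuousOn (fun t => homNorm μ P (x t) ^ (-μ) + -μ * c * t) (Set.Icc a b) := by
    refine ContinuousOn.add ?_ (by fun_prop)
    refine ContinuousOn.rpow_const ?_ fun _ _ => Or.inr (by linarith)
    exact h.continuous_homNorm.comp_continuousOn
      (hx.continuousOn.mono (Set.Icc_subset_Icc ha hb))
  have hder : ∀ t ∈ Set.Ioo a b, HasDerivAt (fun t => homNorm μ P (x t) ^ (-μ) + -μ * c * t)
      (-μ * decayRate μ lam P (homProj μ P (x t)) + -μ * c) t := by
    intro t ht
    have hxt := hx.hasDerivAt t ⟨ha.trans_lt ht.1, ht.2.trans_le hb⟩ (h0 t ht)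
    have h1 := hasDerivAt_homLog h.toIsMonotoneDilation hxt (h0 t ht)
    have h2 := (h1.const_mul (-μ)).exp
    have h3 : HasDerivAt (fun t => -μ * c * t) (-μ * c) t := by
      simpa using (hasDerivAt_id t).const_mul (-μ * c)
    refine HasDerivAt.congr_of_eventuallyEq ((h2.add h3).congr_deriv ?_) ?_
    -- The power -μ is chosen so that the factor e^{μℓ} in ℓ' cancels.
    · have h4 : Real.exp (-μ * homLog μ P (x t)) * Real.exp (μ * homLog μ P (x t)) = 1 := by
        rw [← Real.exp_add]
        simp
      linear_combination (-μ * decayRate μ lam P (homProj μ P (x t))) * h4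
    · filter_upwards [hxt.continuousAt.eventually_ne (h0 t ht)] with r hr
      simp only [Pi.add_apply]
      rw [homNorm_eq_exp hr, ← Real.exp_mul, mul_comm (homLog μ P (x r))]
  have hanti : AntitoneOn (fun t => homNorm μ P (x t) ^ (-μ) + -μ * c * t) (Set.Icc a b) := by
    refine antitoneOn_of_deriv_nonpos (convex_Icc _ _) hcont ?_ ?_
    · rw [interior_Icc]
      exact fun t ht => (hder t ht).differentiableAt.differentiableWithinAt
    · rw [interior_Icc]
      intro t ht
      rw [(hder t ht).deriv]
      nlinarith [hle _ (homProj_ne_zero (μ := μ) (P := P) (h0 t ht))]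
  have := hanti (Set.left_mem_Icc.2 hab) (Set.right_mem_Icc.2 hab) hab
  simp only at this
  linarith

/-- After the last zero before b, the power ‖x‖_d^{-μ} would have to decrease from 0 to a positive
value. No Lipschitz condition at the origin is needed. -/
lemma eq_zero_of_eq_zero (h : IsHomogeneousLoop μ lam P) {τ : ℝ} {x : ℝ → Fin n → ℝ}
    (hx : IsAgentSolution μ lam P τ x) {a b : ℝ} (ha : 0 ≤ a) (hab : a ≤ b) (hb : b ≤ τ)
    (h0 : x a = 0) : x b = 0 := by
  obtain ⟨c, hc, hdec⟩ := h.exists_homNorm_rpow_decrease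
  by_contra hxb
  set S : Set ℝ := Set.Icc a b ∩ x ⁻¹' {0} with hS
  have hclosed : IsClosed S :=
    (hx.continuousOn.mono (Set.Icc_subset_Icc ha hb)).preimage_isClosed_of_isClosed isClosed_Icc
      isClosed_singleton
  have hne : S.Nonempty := ⟨a, ⟨le_rfl, hab⟩, h0⟩
  have hbdd : BddAbove S := ⟨b, fun t ht => ht.1.2⟩
  have hmem : sSup S ∈ S := hclosed.csSup_mem hne hbdd
  have hz : x (sSup S) = 0 := hmem.2
  have h1 := hdec τ x hx (sSup S) b (ha.trans hmem.1.1) hmem.1.2 hb fun t ht h0' =>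
    absurd (le_csSup hbdd ⟨⟨hmem.1.1.trans ht.1.le, ht.2.le⟩, h0'⟩) (not_le.2 ht.1)
  rw [hz, homNorm_zero, Real.zero_rpow (by linarith [h.degree_neg])] at h1
  have h2 : 0 < homNorm μ P (x b) ^ (-μ) := Real.rpow_pos_of_pos (homNorm_pos hxb) _
  nlinarith [mul_nonneg hc.le (sub_nonneg.2 hmem.1.2)]

lemma ne_zero_of_ne_zero (h : IsHomogeneousLoop μ lam P) {τ : ℝ} {x : ℝ → Fin n → ℝ}
    (hx : IsAgentSolution μ lam P τ x) {a b : ℝ} (ha : 0 ≤ a) (hab : a ≤ b) (hb : b ≤ τ)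
    (h0 : x b ≠ 0) : x a ≠ 0 :=
  fun h' => h0 (h.eq_zero_of_eq_zero hx ha hab hb h')

lemma homNorm_le_initial (h : IsHomogeneousLoop μ lam P) {τ : ℝ} {x : ℝ → Fin n → ℝ}
    (hx : IsAgentSolution μ lam P τ x) {t : ℝ} (ht : t ∈ Set.Icc 0 τ) :
    homNorm μ P (x t) ≤ homNorm μ P (x 0) := by
  by_cases h0 : x t = 0
  · rw [h0, homNorm_zero]
    exact homNorm_nonneg _
  · obtain ⟨c, hc, hdec⟩ := h.exists_homNorm_rpow_decrease
    have h1 := hdec τ x hx 0 t le_rfl ht.1 ht.2 fun r hr =>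
      h.ne_zero_of_ne_zero hx hr.1.le hr.2.le ht.2 h0
    have h2 : homNorm μ P (x t) ^ (-μ) ≤ homNorm μ P (x 0) ^ (-μ) := by
      nlinarith [ht.1]
    exact (Real.rpow_le_rpow_iff (homNorm_nonneg _) (homNorm_nonneg _)
      (by linarith [h.degree_neg])).1 h2

lemma exists_settlingTime (h : IsHomogeneousLoop μ lam P) :
    ∃ T : (Fin n → ℝ) → ℝ, (∀ z, 0 < T z) ∧ ∀ τ x, IsAgentSolution μ lam P τ x →
      ∀ t ∈ Set.Icc 0 τ, T (x 0) ≤ t → x t = 0 := by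
  obtain ⟨c, hc, hdec⟩ := h.exists_homNorm_rpow_decrease
  -- Initial value of the decreasing power divided by its rate; the 1 makes the time positive also
  -- at z = 0.
  refine ⟨fun z => homNorm μ P z ^ (-μ) / c + 1, fun z => ?_, fun τ x hx t ht hT => ?_⟩
  · have := Real.rpow_nonneg (homNorm_nonneg (μ := μ) (P := P) z) (-μ)
    positivity
  · by_contra h0
    have h1 := hdec τ x hx 0 t le_rfl ht.1 ht.2 fun r hr =>
      h.ne_zero_of_ne_zero hx hr.1.le hr.2.le ht.2 h0
    have h2 : 0 < homNorm μ P (x t) ^ (-μ) := Real.rpow_pos_of_pos (homNorm_pos h0) _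
    have h3 : homNorm μ P (x 0) ^ (-μ) / c < t := by linarith
    rw [div_lt_iff₀ hc] at h3
    linarith

/-- The homogeneous cone is positively invariant for a single agent. -/
lemma matH_homProj_nonneg (h : IsHomogeneousLoop μ lam P) {τ : ℝ} {x : ℝ → Fin n → ℝ}
    (hx : IsAgentSolution μ lam P τ x) (h0 : 0 ≤ matH n lam *ᵥ homProj μ P (x 0)) {t : ℝ}
    (ht : t ∈ Set.Icc 0 τ) : 0 ≤ matH n lam *ᵥ homProj μ P (x t) := by
  by_cases hxt : x t = 0
  · simp [hxt, homProj_zero]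
  -- A solution that is nonzero at t was never zero before, so the angular equation holds on (0, t)
  -- and its coefficients are bounded by compactness.
  have hne : ∀ r ∈ Set.Icc 0 t, x r ≠ 0 := fun r hr =>
    h.ne_zero_of_ne_zero hx hr.1 hr.2 ht.2 hxt
  have hm := h.toIsMonotoneDilation
  have hxc : ContinuousOn x (Set.Icc 0 t) :=
    hx.continuousOn.mono (Set.Icc_subset_Icc le_rfl ht.2)
  have hsc : ContinuousOn (fun r => homLog μ P (x r)) (Set.Icc 0 t) :=
    hm.continuousOn_homLog.comp hxc hne
  have hyc : ContinuousOn (fun r => homProj μ P (x r)) (Set.Icc 0 t) :=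
    hm.continuousOn_homProj.comp hxc hne
  have hrc : ContinuousOn (fun r => decayRate μ lam P (homProj μ P (x r))) (Set.Icc 0 t) :=
    (continuousOn_decayRate hm).comp hyc fun r hr => homProj_ne_zero (hne r hr)
  set a : ℝ → Matrix (Fin n) (Fin n) ℝ := fun r =>
    Real.exp (μ * homLog μ P (x r)) • ((chainA n - lam • (1 : Matrix (Fin n) (Fin n) ℝ)) -
      decayRate μ lam P (homProj μ P (x r)) • generatorH n μ lam) with ha
  have hac : ∀ i j, ContinuousOn (fun r => a r i j) (Set.Icc 0 t) := by
    intro i j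
    simp only [ha, Matrix.smul_apply, Matrix.sub_apply, smul_eq_mul]
    exact ((continuousOn_const.mul hsc).rexp).mul
      (continuousOn_const.sub (hrc.mul continuousOn_const))
  obtain ⟨D, hD⟩ := isCompact_Icc.bddAbove_image
    (continuousOn_finsetSum Finset.univ fun i _ =>
      continuousOn_finsetSum Finset.univ fun j _ => (hac i j).abs)
  refine nonneg_of_metzler (ξ := fun r => matH n lam *ᵥ homProj μ P (x r)) (a := a) (D := D)
    ht.1 ?_ ?_ ?_ ?_ h0
  · exact (continuous_const.matrix_mulVec continuous_id).comp_continuousOn hyc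
  · intro r hr
    have hr' : r ∈ Set.Icc 0 t := ⟨hr.1.le, hr.2.le⟩
    have h1 := hasDerivAt_homProj hm
      (hx.hasDerivAt r ⟨hr.1, hr.2.trans_le ht.2⟩ (hne r hr')) (hne r hr')
    have h2 := ((Matrix.mulVecLin (matH n lam)).toContinuousLinearMap).hasFDerivAt.comp_hasDerivAt
      r h1
    refine h2.congr_deriv ?_
    simp only [LinearMap.coe_toContinuousLinearMap', Matrix.mulVecLin_apply, Matrix.mulVec_smul,
      Matrix.mulVec_sub, matH_mulVec_closedLoop, matH_mulVec_generator, ha, Matrix.smul_mulVec,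
      Matrix.sub_mulVec]
  · intro r hr i j
    refine le_trans ?_ (hD ⟨r, ⟨hr.1.le, hr.2.le⟩, rfl⟩)
    refine le_trans ?_ (Finset.single_le_sum (f := fun i => ∑ j, |a r i j|)
      (fun i _ => Finset.sum_nonneg fun j _ => abs_nonneg _) (Finset.mem_univ i))
    exact Finset.single_le_sum (f := fun j => |a r i j|) (fun j _ => abs_nonneg _)
      (Finset.mem_univ j)
  · intro r hr i j hij
    have h1 := h.decayRate_neg (homProj_ne_zero (μ := μ) (P := P) (hne r ⟨hr.1.le, hr.2.le⟩))
    have h2 := generatorH_nonneg h.degree_neg.le h.lam_pos.le hij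
    have h3 := chainA_sub_nonneg (lam := lam) hij
    have h4 := Real.exp_pos (μ * homLog μ P (x r))
    rw [ha]
    simp only [Matrix.smul_apply, Matrix.sub_apply, smul_eq_mul] at h3 ⊢
    refine mul_nonneg h4.le ?_
    nlinarith [mul_nonneg (neg_nonneg.2 h1.le) h2]

/-- Points of the linear cone in the unit ball belong to the homogeneous cone. -/
lemma matH_homProj_nonneg_of_pNorm_le (h : IsHomogeneousLoop μ lam P) {z : Fin n → ℝ}
    (hz : 0 ≤ matH n lam *ᵥ z) (h1 : pNorm P z ≤ 1) : 0 ≤ matH n lam *ᵥ homProj μ P z := by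
  by_cases h0 : z = 0
  · simp [h0, homProj_zero]
  have hq : quad P z ≤ 1 := by
    rwa [pNorm, Real.sqrt_le_one] at h1
  have hs : homLog μ P z ≤ 0 := by
    rw [h.homLog_le_iff h0, neg_zero, dil_zero_mulVec]
    exact hq
  -- The curve r ↦ H d(r) z is followed from 0 to -ln ‖z‖_d, a nonnegative parameter exactly because
  -- z lies in the unit ball.
  have hd : ∀ r, HasDerivAt (fun r => matH n lam *ᵥ (dil n μ r *ᵥ z))
      (generatorH n μ lam *ᵥ (matH n lam *ᵥ (dil n μ r *ᵥ z))) r := by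
    intro r
    have e1 := hasDerivAt_dil_mulVec μ (hasDerivAt_id r) (hasDerivAt_const r z)
    have e2 := ((Matrix.mulVecLin (matH n lam)).toContinuousLinearMap).hasFDerivAt.comp_hasDerivAt
      r e1
    refine e2.congr_deriv ?_
    rw [← matH_mulVec_generator, Matrix.mulVec_zero, zero_add, one_smul]
    rfl
  obtain ⟨D, hD⟩ : ∃ D, ∀ i j, |generatorH n μ lam i j| ≤ D := by
    refine ⟨∑ i, ∑ j, |generatorH n μ lam i j|, fun i j => ?_⟩
    refine le_trans ?_ (Finset.single_le_sum (f := fun i => ∑ j, |generatorH n μ lam i j|)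
      (fun i _ => Finset.sum_nonneg fun j _ => abs_nonneg _) (Finset.mem_univ i))
    exact Finset.single_le_sum (f := fun j => |generatorH n μ lam i j|) (fun j _ => abs_nonneg _)
      (Finset.mem_univ j)
  have := nonneg_of_metzler (ξ := fun r => matH n lam *ᵥ (dil n μ r *ᵥ z))
    (a := fun _ => generatorH n μ lam) (D := D) (neg_nonneg.2 hs)
    (fun r _ => (hd r).continuousAt.continuousWithinAt) (fun r _ => hd r) (fun _ _ => hD)
    (fun _ _ i j hij => generatorH_nonneg h.degree_neg.le h.lam_pos.le hij)
    (by simpa only [dil_zero_mulVec] using hz)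
  exact this

end IsHomogeneousLoop

/-! ### Global solutions -/

open scoped Manifold in
/-- A compactly supported `C¹` vector field has global integral curves. -/
lemma exists_integralCurve_of_hasCompactSupport {E : Type*} [NormedAddCommGroup E]
    [NormedSpace ℝ E] [CompleteSpace E] {W : E → E} (hW : ContDiff ℝ 1 W)
    (hc : HasCompactSupport W) (x : E) :
    ∃ γ : ℝ → E, γ 0 = x ∧ ∀ t, HasDerivAt γ (W (γ t)) t := by
  obtain ⟨K, hK⟩ := hW.lipschitzWith_of_hasCompactSupport hc one_ne_zero
  obtain ⟨L, hL⟩ := hc.exists_bound_of_continuous hW.continuous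
  have hloc : ∀ a : ℝ, ∃ γ : ℝ → E, γ 0 = x ∧
      IsMIntegralCurveOn (I := 𝓘(ℝ, E)) γ W (Set.Ioo (-a) a) := by
    intro a
    rcases le_or_gt a 0 with ha | ha
    · refine ⟨fun _ => x, rfl, fun t ht => ?_⟩
      linarith [ht.1, ht.2]
    -- A curve of speed at most L stays within distance L a during time a, so a ball of that radius
    -- suffices for every a.
    · have hpl : IsPicardLindelof (fun _ => W) (tmin := -a) (tmax := a)
          ⟨0, by linarith, ha.le⟩ x (L.toNNReal * a.toNNReal) 0 L.toNNReal K := by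
        refine ⟨fun _ _ => hK.lipschitzOnWith, fun _ _ => continuousOn_const,
          fun _ _ y _ => (hL y).trans (Real.le_coe_toNNReal L), ?_⟩
        simp [ha.le]
      obtain ⟨α, hα0, hα⟩ := hpl.exists_eq_forall_mem_Icc_hasDerivWithinAt₀
      refine ⟨α, hα0, fun t ht => ?_⟩
      have h1 : HasDerivAt α (W (α t)) t :=
        (hα t ⟨ht.1.le, ht.2.le⟩).hasDerivAt (Icc_mem_nhds ht.1 ht.2)
      exact h1.hasFDerivAt.hasMFDerivAt.hasMFDerivWithinAt
  obtain ⟨γ, h0, hγ⟩ := (exists_isMIntegralCurve_iff_exists_isMIntegralCurveOn_Ioo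
    (I := 𝓘(ℝ, E)) (v := W) (contMDiff_vectorSpace_iff_contDiff.2 hW) x).2 hloc
  refine ⟨γ, h0, fun t => ?_⟩
  have h1 : HasFDerivAt γ ((1 : ℝ →L[ℝ] ℝ).smulRight (W (γ t))) t := (hγ t).hasFDerivAt
  simpa using h1.hasDerivAt

namespace IsHomogeneousLoop

open IsMonotoneDilation

variable {n : ℕ} {μ lam : ℝ} {P : Matrix (Fin n) (Fin n) ℝ}

/-- The angular part of the closed loop in the time scale in which it is polynomial. -/
noncomputable def sphereField (μ lam : ℝ) (P : Matrix (Fin n) (Fin n) ℝ) (y : Fin n → ℝ) :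
    Fin n → ℝ :=
  quad (P * generator n μ + generator n μ * P) y • (closedLoopMatrix n lam *ᵥ y) -
    quad (P * closedLoopMatrix n lam + (closedLoopMatrix n lam)ᵀ * P) y • (generator n μ *ᵥ y)

lemma contDiff_mulVec (M : Matrix (Fin n) (Fin n) ℝ) {m : WithTop ℕ∞} :
    ContDiff ℝ m fun y : Fin n → ℝ => M *ᵥ y := by
  rw [contDiff_pi]
  intro k
  unfold Matrix.mulVec dotProduct
  fun_prop

/-- `sphereField` is tangent to the compact sphere yᵀPy = 1. Multiplying by a cut-off keeps the
tangency and changes nothing on the sphere, so the curve of the cut-off field is already the one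
wanted. -/
lemma exists_sphereCurve (h : IsMonotoneDilation μ P) {y₀ : Fin n → ℝ} (hy₀ : quad P y₀ = 1) :
    ∃ y : ℝ → Fin n → ℝ, y 0 = y₀ ∧ (∀ t, quad P (y t) = 1) ∧
      ∀ t, HasDerivAt y (sphereField μ lam P (y t)) t := by
  obtain ⟨c, hc, hle⟩ := exists_le_quad h.posDef
  have hR : ∀ y, quad P y = 1 → y ∈ Metric.closedBall (0 : Fin n → ℝ) (1 / c + 1) := by
    intro y hy
    have h1 := hle y
    rw [hy, ← le_div_iff₀' hc] at h1
    rw [mem_closedBall_zero_iff]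
    nlinarith [sq_nonneg (‖y‖ - 1)]
  have hc0 : 0 < 1 / c + 1 := by positivity
  let χ : ContDiffBump (0 : Fin n → ℝ) := ⟨1 / c + 1, 1 / c + 2, hc0, by linarith⟩
  have hW : ContDiff ℝ 1 fun y => χ y • sphereField μ lam P y := by
    refine ContDiff.smul χ.contDiff (ContDiff.sub ?_ ?_)
    · exact (contDiff_quad _).smul (contDiff_mulVec _)
    · exact (contDiff_quad _).smul (contDiff_mulVec _)
  obtain ⟨y, h0, hy⟩ := exists_integralCurve_of_hasCompactSupport hW
    χ.hasCompactSupport.smul_right y₀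
  have hq : ∀ t, HasDerivAt (fun t => quad P (y t)) 0 t := by
    intro t
    refine (HasDerivAt.quad P (hy t)).congr_deriv ?_
    have hM := quad_lyapunov P (closedLoopMatrix n lam) (y t)
    have hG := quad_lyapunov P (generator n μ) (y t)
    rw [generator_transpose] at hG
    simp only [sphereField, ← hM, ← hG]
    simp only [smul_dotProduct, sub_dotProduct, dotProduct_sub, Matrix.mulVec_sub,
      Matrix.mulVec_smul, dotProduct_smul, smul_eq_mul]
    ring
  have hone : ∀ t, quad P (y t) = 1 := by
    intro t
    rw [is_const_of_deriv_eq_zero (fun t => (hq t).differentiableAt) (fun t => (hq t).deriv) t 0,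
      h0, hy₀]
  refine ⟨y, h0, hone, fun t => (hy t).congr_deriv ?_⟩
  rw [χ.one_of_mem_closedBall (hR _ (hone t)), one_smul]

/-- A reparametrised trajectory of the closed loop: `X' = σ' f(X)` with `σ` increasing and bounded
on `[0, ∞)` and `X → 0`. -/
lemma exists_reparametrised (h : IsHomogeneousLoop μ lam P) {z : Fin n → ℝ} (hz : z ≠ 0) :
    ∃ (X : ℝ → Fin n → ℝ) (σ σ' : ℝ → ℝ), X 0 = z ∧ σ 0 = 0 ∧ (∀ r, X r ≠ 0) ∧
      (∀ r, 0 < σ' r) ∧ (∀ r, HasStrictDerivAt σ (σ' r) r) ∧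
      (∀ r, HasDerivAt X (σ' r • agentField μ lam P (X r)) r) ∧
      BddAbove (Set.range σ) ∧ Filter.Tendsto X Filter.atTop (nhds 0) := by
  have hm := h.toIsMonotoneDilation
  have hμ := h.degree_neg
  obtain ⟨y, hy0, hyP, hy⟩ := exists_sphereCurve (lam := lam) hm (hm.quad_homProj hz)
  have hyne : ∀ r, y r ≠ 0 := by
    intro r hr
    have := hyP r
    rw [hr, quad_zero] at this
    exact zero_ne_one this
  have hyc : Continuous y := continuous_iff_continuousAt.2 fun r => (hy r).continuousAt
  set qb : ℝ → ℝ := fun r => quad (P * generator n μ + generator n μ * P) (y r) with hqb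
  set qa : ℝ → ℝ := fun r =>
    quad (P * closedLoopMatrix n lam + (closedLoopMatrix n lam)ᵀ * P) (y r) with hqa
  have hqbc : Continuous qb := (continuous_quad _).comp hyc
  have hqac : Continuous qa := (continuous_quad _).comp hyc
  have hqbpos : ∀ r, 0 < qb r := fun r => quad_gen_pos hm (hyne r)
  obtain ⟨c₁, hc₁, hle₁⟩ := h.exists_decayRate_le
  have hqa_le : ∀ r, qa r ≤ -c₁ * qb r := by
    intro r
    have := hle₁ (y r) (hyne r)
    rwa [decayRate, div_le_iff₀ (hqbpos r)] at this
  obtain ⟨c₂, hc₂, hle₂⟩ := exists_quad_le_quad hm.posDef_gen P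
  have hqb_ge : ∀ r, c₂ ≤ qb r := by
    intro r
    have := hle₂ (y r)
    rwa [hyP, mul_one] at this
  -- With new time r and physical time σ, σ' = qb e^{-μs}, the radial equation becomes s' = qa and
  -- the angular one becomes `sphereField`.
  set s : ℝ → ℝ := fun r => homLog μ P z + ∫ u in (0 : ℝ)..r, qa u with hs
  have hsd : ∀ r, HasDerivAt s (qa r) r := fun r =>
    (hqac.integral_hasStrictDerivAt 0 r).hasDerivAt.const_add _
  have hsc : Continuous s := continuous_iff_continuousAt.2 fun r => (hsd r).continuousAt
  set σ' : ℝ → ℝ := fun r => qb r * Real.exp (-μ * s r) with hσ'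
  have hσ'c : Continuous σ' := hqbc.mul (by fun_prop)
  set σ : ℝ → ℝ := fun r => ∫ u in (0 : ℝ)..r, σ' u with hσ
  have hσd : ∀ r, HasStrictDerivAt σ (σ' r) r := fun r => hσ'c.integral_hasStrictDerivAt 0 r
  have hσ'pos : ∀ r, 0 < σ' r := fun r => mul_pos (hqbpos r) (Real.exp_pos _)
  have hσmono : StrictMono σ := strictMono_of_deriv_pos fun r => by
    rw [(hσd r).hasDerivAt.deriv]
    exact hσ'pos r
  set X : ℝ → Fin n → ℝ := fun r => dil n μ (s r) *ᵥ y r with hX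
  have hXlog : ∀ r, homLog μ P (X r) = s r := by
    intro r
    refine hm.homLog_eq ?_
    rw [hX]
    simp only
    rw [← dil_add_mulVec, neg_add_cancel, dil_zero_mulVec, hyP]
  have hXproj : ∀ r, homProj μ P (X r) = y r := by
    intro r
    rw [homProj_eq, hXlog, hX]
    simp only
    rw [← dil_add_mulVec, neg_add_cancel, dil_zero_mulVec]
  have hXne : ∀ r, X r ≠ 0 := fun r => dil_mulVec_eq_zero.not.2 (hyne r)
  refine ⟨X, σ, σ', ?_, ?_, hXne, hσ'pos, hσd, ?_, ?_, ?_⟩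
  · simp only [hX, hs, intervalIntegral.integral_same, add_zero, hy0]
    exact dil_homLog_homProj z
  · simp [hσ]
  · intro r
    refine (hasDerivAt_dil_mulVec μ (hsd r) (hy r)).congr_deriv ?_
    rw [agentField_eq (hXne r), hXlog, hXproj, sphereField, Matrix.mulVec_sub, Matrix.mulVec_smul,
      Matrix.mulVec_smul, smul_smul]
    have e1 : σ' r * Real.exp (μ * s r) = qb r := by
      rw [hσ', mul_assoc, ← Real.exp_add]
      simp
    have e2 : dil n μ (s r) *ᵥ (generator n μ *ᵥ y r) =
        generator n μ *ᵥ (dil n μ (s r) *ᵥ y r) := by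
      ext k
      simp only [dil_mulVec_apply, generator_mulVec_apply]
      ring
    rw [e1, e2]
    exact sub_add_cancel _ _
  -- The decrease of ‖X‖_d^{-μ} at a constant rate in physical time bounds the total physical time.
  · have hanti : Antitone fun r => Real.exp (-μ * s r) + -μ * c₁ * σ r := by
      have hd : ∀ r, HasDerivAt (fun r => Real.exp (-μ * s r) + -μ * c₁ * σ r)
          (Real.exp (-μ * s r) * (-μ * qa r) + -μ * c₁ * σ' r) r := fun r =>
        ((hsd r).const_mul (-μ)).exp.add ((hσd r).hasDerivAt.const_mul _)
      refine antitone_of_deriv_nonpos (fun r => (hd r).differentiableAt) fun r => ?_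
      rw [(hd r).deriv, hσ']
      have e1 := hqa_le r
      have e2 := Real.exp_pos (-μ * s r)
      have e3 : 0 < -μ * Real.exp (-μ * s r) := mul_pos (by linarith) e2
      nlinarith [mul_nonneg e3.le (sub_nonneg.2 e1)]
    have hpos : 0 < -μ * c₁ := mul_pos (by linarith) hc₁
    refine ⟨max 0 ((Real.exp (-μ * s 0) + -μ * c₁ * σ 0) / (-μ * c₁)), ?_⟩
    rintro _ ⟨r, rfl⟩
    rcases le_total r 0 with hr | hr
    · refine le_max_of_le_left ?_
      have := hσmono.monotone hr
      simpa [hσ] using this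
    · refine le_max_of_le_right ?_
      rw [le_div_iff₀ hpos]
      have e1 := hanti hr
      simp only at e1
      have e2 := Real.exp_pos (-μ * s r)
      linarith
  · obtain ⟨C, hC, hCle⟩ := hm.exists_norm_homProj_le
    have hslim : Filter.Tendsto s Filter.atTop Filter.atBot := by
      -- In the new time ln ‖X‖_d falls at least linearly, so X tends to 0.
      have hanti : Antitone fun r => s r + c₁ * c₂ * r := by
        have hd : ∀ r, HasDerivAt (fun r => s r + c₁ * c₂ * r) (qa r + c₁ * c₂) r := fun r =>
          (hsd r).add (by simpa using (hasDerivAt_id r).const_mul (c₁ * c₂))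
        refine antitone_of_deriv_nonpos (fun r => (hd r).differentiableAt) fun r => ?_
        rw [(hd r).deriv]
        nlinarith [hqa_le r, hqb_ge r]
      have hb : Filter.Tendsto (fun r => s 0 + -(c₁ * c₂ * r)) Filter.atTop Filter.atBot :=
        Filter.tendsto_atBot_add_const_left _ _ (Filter.tendsto_neg_atTop_atBot.comp
          (Filter.tendsto_id.const_mul_atTop (mul_pos hc₁ hc₂)))
      refine Filter.tendsto_atBot_mono' _ ?_ hb
      filter_upwards [Filter.eventually_ge_atTop 0] with r hr
      have := hanti hr
      simp only [mul_zero, add_zero] at this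
      linarith
    have hbound : Filter.Tendsto (fun r => Real.exp (s r) * C) Filter.atTop (nhds 0) := by
      simpa using (Real.tendsto_exp_atBot.comp hslim).mul_const C
    refine squeeze_zero_norm' ?_ hbound
    filter_upwards [hslim.eventually_le_atBot 0] with r hr
    refine (norm_dil_mulVec_le hμ.le hr (y r)).trans ?_
    gcongr
    rw [← hXproj r]
    exact hCle _

/-- Global finite-time solutions of the closed loop of one agent. -/
lemma exists_trajectory (h : IsHomogeneousLoop μ lam P) (z : Fin n → ℝ) :
    ∃ (x : ℝ → Fin n → ℝ) (T : ℝ), x 0 = z ∧ ContinuousOn x (Set.Ici 0) ∧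
      ∀ t, 0 ≤ t → t ≠ T → HasDerivAt x (agentField μ lam P (x t)) t := by
  by_cases hz : z = 0
  · refine ⟨fun _ => 0, 0, hz.symm, continuousOn_const, fun t _ _ => ?_⟩
    rw [agentField_zero]
    exact hasDerivAt_const _ _
  obtain ⟨X, σ, σ', hX0, hσ0, hXne, hσ'pos, hσd, hXd, hbdd, hXlim⟩ := h.exists_reparametrised hz
  have hmono : StrictMono σ := strictMono_of_deriv_pos fun r => by
    rw [(hσd r).hasDerivAt.deriv]
    exact hσ'pos r
  have hcont : Continuous σ := continuous_iff_continuousAt.2 fun r => (hσd r).hasDerivAt.continuousAt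
  -- The physical time at which the origin is reached; from then on the trajectory is set to 0.
  set T : ℝ := sSup (Set.range σ) with hT
  have hlt : ∀ r, σ r < T := fun r =>
    (hmono (lt_add_one r)).trans_le (le_csSup hbdd ⟨r + 1, rfl⟩)
  have hsurj : ∀ t, 0 ≤ t → t < T → ∃ r, σ r = t := by
    intro t ht htT
    obtain ⟨_, ⟨r, rfl⟩, hr⟩ := exists_lt_of_lt_csSup (Set.range_nonempty σ) htT
    exact mem_range_of_exists_le_of_exists_ge hcont ⟨0, by rwa [hσ0]⟩ ⟨r, hr.le⟩
  set g : ℝ → ℝ := Function.invFun σ with hg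
  have hgσ : ∀ r, g (σ r) = r := Function.leftInverse_invFun hmono.injective
  set x : ℝ → Fin n → ℝ := fun t => if t < T then X (g t) else 0 with hx
  have hxσ : ∀ r, x (σ r) = X r := fun r => by rw [hx]; simp only; rw [if_pos (hlt r), hgσ]
  have hxT : ∀ t, T ≤ t → x t = 0 := fun t ht => if_neg (not_lt.2 ht)
  have hder : ∀ t, 0 ≤ t → t ≠ T → HasDerivAt x (agentField μ lam P (x t)) t := by
    intro t ht htT
    rcases lt_or_gt_of_ne htT with hlt' | hgt
    · obtain ⟨r, rfl⟩ := hsurj t ht hlt'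
      have h1 : HasDerivAt g (σ' r)⁻¹ (σ r) :=
        ((hσd r).to_local_left_inverse (hσ'pos r).ne'
          (Filter.Eventually.of_forall hgσ)).hasDerivAt
      have h2 : HasDerivAt X (σ' r • agentField μ lam P (X r)) (g (σ r)) := by
        rw [hgσ]
        exact hXd r
      have h3 := h2.scomp (σ r) h1
      rw [smul_smul, inv_mul_cancel₀ (hσ'pos r).ne', one_smul] at h3
      rw [hxσ]
      refine h3.congr_of_eventuallyEq ?_
      filter_upwards [Iio_mem_nhds (hlt r)] with u hu
      exact if_pos hu
    · rw [hxT t hgt.le, agentField_zero]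
      refine (hasDerivAt_const t (0 : Fin n → ℝ)).congr_of_eventuallyEq ?_
      filter_upwards [Ioi_mem_nhds hgt] with u hu
      exact hxT u (le_of_lt hu)
  refine ⟨x, T, ?_, fun t ht => ?_, hder⟩
  · rw [← hσ0, hxσ, hX0]
  · by_cases htT : t = T
    · subst htT
      refine ContinuousAt.continuousWithinAt ?_
      rw [ContinuousAt, hxT _ le_rfl, Metric.tendsto_nhds]
      intro ε hε
      obtain ⟨r₀, hr₀⟩ := Filter.eventually_atTop.1 ((Metric.tendsto_nhds.1 hXlim) ε hε)
      have hpos : 0 < T := hσ0 ▸ hlt 0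
      filter_upwards [Ioi_mem_nhds (hlt r₀), Ioi_mem_nhds hpos] with u hu hu0
      rcases lt_or_ge u T with huT | huT
      · obtain ⟨r, rfl⟩ := hsurj u (le_of_lt hu0) huT
        rw [hxσ]
        exact hr₀ r (hmono.lt_iff_lt.1 hu).le
      · rw [hxT u huT, dist_self]
        exact hε
    · exact (hder t ht htT).continuousAt.continuousWithinAt

lemma measurable_agentField (h : IsMonotoneDilation μ P) : Measurable (agentField μ lam P) :=
  measurable_of_continuousOn_compl_singleton 0 (continuousOn_agentField h)

lemma exists_integral_solution (h : IsHomogeneousLoop μ lam P) (z : Fin n → ℝ) :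
    ∃ x : ℝ → Fin n → ℝ, x 0 = z ∧ ∀ τ, 0 < τ →
      IntervalIntegrable (fun t => agentField μ lam P (x t)) volume 0 τ ∧
      ∀ t ∈ Set.Icc 0 τ, x t = x 0 + ∫ r in (0 : ℝ)..t, agentField μ lam P (x r) := by
  obtain ⟨x, T, hx0, hxc, hxd⟩ := h.exists_trajectory z
  have hm := h.toIsMonotoneDilation
  obtain ⟨C, hC, hle⟩ := exists_norm_agentField_le (lam := lam) hm
  have hint : ∀ τ, 0 ≤ τ → IntervalIntegrable (fun t => agentField μ lam P (x t)) volume 0 τ := by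
    intro τ hτ
    have hxc' : ContinuousOn x (Set.Icc 0 τ) := hxc.mono Set.Icc_subset_Ici_self
    have hbc : ContinuousOn (fun t => C * (‖x t‖ + homNorm μ P (x t) ^ (1 + μ)))
        (Set.Icc 0 τ) := by
      refine continuousOn_const.mul (hxc'.norm.add ?_)
      exact (hm.continuous_homNorm.comp_continuousOn hxc').rpow_const
        -- The bound μ ≥ -1 makes the exponent nonnegative, so the majorant stays continuous at the
        -- origin.
        fun _ _ => Or.inr (by linarith [h.degree_ge])
    obtain ⟨D, hD⟩ := isCompact_Icc.bddAbove_image hbc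
    rw [intervalIntegrable_iff_integrableOn_Icc_of_le hτ]
    refine ⟨?_, ?_⟩
    · exact ((measurable_agentField hm).comp_aemeasurable
        (hxc'.aemeasurable measurableSet_Icc)).aestronglyMeasurable
    · refine HasFiniteIntegral.restrict_of_bounded (C := D) measure_Icc_lt_top ?_
      refine (ae_restrict_iff' measurableSet_Icc).2 (Filter.Eventually.of_forall fun t ht => ?_)
      exact (hle (x t)).trans (hD ⟨t, ht, rfl⟩)
  refine ⟨x, hx0, fun τ hτ => ⟨hint τ hτ.le, fun t ht => ?_⟩⟩
  -- The derivative may fail to exist at the single time T; continuity there suffices.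
  rw [integral_eq_of_hasDerivAt_off_countable_of_le x _ ht.1 (Set.countable_singleton T)
    (hxc.mono Set.Icc_subset_Ici_self) (fun r hr => hxd r hr.1.1.le hr.2) (hint t ht.1)]
  abel

end IsHomogeneousLoop

/-! ### Filippov regularisation of decoupled fields -/

/-- Component i of the field depends on e_i only, so near e its values lie in a small closed convex
ball about φ(e_i), whatever happens in the components that vanish. -/
lemma filippov_apply_eq {N n : ℕ} {φ : (Fin n → ℝ) → Fin n → ℝ} (hφ : ContinuousOn φ {0}ᶜ)
    {e g : Fin N → Fin n → ℝ} (hg : g ∈ filippov (fun e i => φ (e i)) e) {i : Fin N}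
    (hi : e i ≠ 0) : g i = φ (e i) := by
  refine eq_of_forall_dist_le fun ε hε => ?_
  have hc : ContinuousAt φ (e i) := hφ.continuousAt (isOpen_compl_singleton.mem_nhds hi)
  obtain ⟨δ, hδ, hball⟩ := Metric.continuousAt_iff.1 hc ε hε
  have h1 := Set.mem_iInter₂.1 (Set.mem_iInter₂.1 hg δ hδ) ∅ measure_empty
  have hconv : Convex ℝ {v : Fin N → Fin n → ℝ | v i ∈ Metric.closedBall (φ (e i)) ε} := by
    intro u hu v hv a b ha hb hab
    exact convex_closedBall (φ (e i)) ε hu hv ha hb hab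
  have hclosed : IsClosed {v : Fin N → Fin n → ℝ | v i ∈ Metric.closedBall (φ (e i)) ε} :=
    Metric.isClosed_closedBall.preimage (continuous_apply i)
  have hsub : (fun e : Fin N → Fin n → ℝ => fun i => φ (e i)) '' (Metric.ball e δ \ ∅) ⊆
      {v : Fin N → Fin n → ℝ | v i ∈ Metric.closedBall (φ (e i)) ε} := by
    rintro _ ⟨e', he', rfl⟩
    exact Metric.mem_closedBall.2 (hball ((dist_le_pi_dist e' e i).trans_lt he'.1)).le
  exact Metric.mem_closedBall.1 (closure_minimal (convexHull_min hsub hconv) hclosed h1)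

/-- The reflection of the components of `e'` in which `e` vanishes. -/
noncomputable def reflectZeros {N n : ℕ} (e e' : Fin N → Fin n → ℝ) : Fin N → Fin n → ℝ :=
  open Classical in fun i => if e i = 0 then -e' i else e' i

lemma measurePreserving_reflectZeros {N n : ℕ} (e : Fin N → Fin n → ℝ) :
    MeasurePreserving (reflectZeros e) volume volume := by
  classical
  refine volume_preserving_pi (f := fun i (v : Fin n → ℝ) => if e i = 0 then -v else v) fun i => ?_
  split_ifs
  · exact Measure.measurePreserving_neg volume
  · exact MeasurePreserving.id volume

/-- The values of a decoupled odd field that is continuous away from the origin belong to its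
Filippov regularisation. -/
lemma mem_filippov_of_odd {N n : ℕ} {φ : (Fin n → ℝ) → Fin n → ℝ} (hφ : ContinuousOn φ {0}ᶜ)
    (hodd : ∀ z, φ (-z) = -φ z) (e : Fin N → Fin n → ℝ) :
    (fun i => φ (e i)) ∈ filippov (fun e i => φ (e i)) e := by
  classical
  have hφ0 : φ 0 = 0 := by
    have := hodd 0
    rw [neg_zero] at this
    exact self_eq_neg.1 this
  simp only [filippov, Set.mem_iInter]
  intro δ hδ Z hZ
  rw [Metric.mem_closure_iff]
  intro ε hε
  have hev : ∀ᶠ e' in nhds e, ∀ i, e i ≠ 0 → dist (φ (e' i)) (φ (e i)) < ε := by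
    rw [Filter.eventually_all]
    intro i
    by_cases hi : e i = 0
    · simp [hi]
    · have hc : ContinuousAt φ (e i) := hφ.continuousAt (isOpen_compl_singleton.mem_nhds hi)
      have h1 : Filter.Tendsto (fun e' : Fin N → Fin n → ℝ => φ (e' i)) (nhds e)
          (nhds (φ (e i))) := hc.tendsto.comp (continuous_apply i).continuousAt
      filter_upwards [Metric.tendsto_nhds.1 h1 ε hε] with e' he' _
      exact he'
  obtain ⟨δ', hδ', hball⟩ := Metric.eventually_nhds_iff_ball.1 hev
  have hZ' : volume (reflectZeros e ⁻¹' Z) = 0 :=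
    (measurePreserving_reflectZeros e).quasiMeasurePreserving.preimage_null hZ
  -- Choose a nearby point such that it and its reflection both avoid the null set Z. In the
  -- midpoint of the two field values the vanishing components of e cancel by oddness, while the
  -- others are close to φ(e_i).
  obtain ⟨e', he', hnot⟩ : ∃ e' ∈ Metric.ball e (min δ δ'), e' ∉ Z ∪ reflectZeros e ⁻¹' Z := by
    by_contra! hcon
    have h1 : volume (Metric.ball e (min δ δ')) = 0 :=
      measure_mono_null hcon (measure_union_null hZ hZ')
    exact (Metric.measure_ball_pos volume e (lt_min hδ hδ')).ne' h1
  rw [Set.mem_union, not_or] at hnot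
  have hrefl : reflectZeros e e' ∈ Metric.ball e (min δ δ') := by
    rw [Metric.mem_ball, dist_pi_lt_iff (lt_min hδ hδ')] at he' ⊢
    intro i
    have := he' i
    simp only [reflectZeros]
    split_ifs with hi
    · rw [hi, dist_zero_right] at this ⊢
      rwa [norm_neg]
    · exact this
  set f : (Fin N → Fin n → ℝ) → Fin N → Fin n → ℝ := fun e i => φ (e i) with hf
  have hm1 : f e' ∈ f '' (Metric.ball e δ \ Z) :=
    ⟨e', ⟨Metric.ball_subset_ball (min_le_left _ _) he', hnot.1⟩, rfl⟩
  have hm2 : f (reflectZeros e e') ∈ f '' (Metric.ball e δ \ Z) :=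
    ⟨_, ⟨Metric.ball_subset_ball (min_le_left _ _) hrefl, hnot.2⟩, rfl⟩
  refine ⟨(1 / 2 : ℝ) • f e' + (1 / 2 : ℝ) • f (reflectZeros e e'),
    convex_convexHull ℝ _ (subset_convexHull ℝ _ hm1) (subset_convexHull ℝ _ hm2)
      (by norm_num) (by norm_num) (by norm_num), ?_⟩
  rw [dist_pi_lt_iff hε]
  intro i
  simp only [hf, Pi.add_apply, Pi.smul_apply, reflectZeros]
  split_ifs with hi
  · rw [hodd, hi, hφ0, smul_neg, add_neg_cancel, dist_self]
    exact hε
  · rw [← add_smul, show (1 / 2 + 1 / 2 : ℝ) = 1 by norm_num, one_smul, dist_comm]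
    exact hball e' (Metric.ball_subset_ball (min_le_right _ _) he') i hi

/-- Every component of a Filippov solution is a classical solution away from the origin. -/
lemma IsSolutionOn.isAgentSolution {N n : ℕ} {μ lam : ℝ} {P : Matrix (Fin n) (Fin n) ℝ}
    (h : IsMonotoneDilation μ P) {τ : ℝ} (hτ : 0 ≤ τ) {x : ℝ → Fin N → Fin n → ℝ}
    (hx : IsSolutionOn (fun e i => agentField μ lam P (e i)) τ x) (i : Fin N) :
    IsAgentSolution μ lam P τ fun t => x t i := by
  obtain ⟨g, hg, hmem, hint⟩ := hx
  have hφ := IsHomogeneousLoop.continuousOn_agentField (lam := lam) h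
  have hcont : ContinuousOn x (Set.Icc 0 τ) := by
    have h1 : ContinuousOn (fun t => x 0 + ∫ s in (0 : ℝ)..t, g s) (Set.Icc 0 τ) := by
      rw [← Set.uIcc_of_le hτ]
      exact continuousOn_const.add
        (intervalIntegral.continuousOn_primitive_interval' hg Set.left_mem_uIcc)
    exact h1.congr hint
  have hci : ContinuousOn (fun t => x t i) (Set.Icc 0 τ) :=
    (continuous_apply i).comp_continuousOn hcont
  refine ⟨hci, fun t ht h0 => ?_⟩
  have hne : ∀ᶠ r in nhds t, r ∈ Set.Ioo 0 τ ∧ x r i ≠ 0 := by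
    have h1 : ContinuousAt (fun t => x t i) t := hci.continuousAt (Icc_mem_nhds ht.1 ht.2)
    exact Filter.Eventually.and (Ioo_mem_nhds ht.1 ht.2) (h1.eventually_ne h0)
  obtain ⟨ε, hε, hball⟩ := Metric.eventually_nhds_iff_ball.1 hne
  have hsub : ∀ r, t - ε / 2 ≤ r → r ≤ t + ε / 2 → r ∈ Set.Ioo 0 τ ∧ x r i ≠ 0 := by
    intro r h1 h2
    refine hball r ?_
    rw [Metric.mem_ball, Real.dist_eq, abs_lt]
    constructor <;> linarith
  set a := t - ε / 2 with ha
  set b := t + ε / 2 with hb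
  have hat : a < t := by linarith
  have htb : t < b := by linarith
  have haI := (hsub a le_rfl (by linarith)).1
  have hφc : ContinuousOn (fun r => agentField μ lam P (x r i)) (Set.Icc a b) :=
    hφ.comp (hci.mono fun r hr => ⟨(hsub r hr.1 hr.2).1.1.le, (hsub r hr.1 hr.2).1.2.le⟩)
      fun r hr => (hsub r hr.1 hr.2).2
  -- Near t component i does not vanish, so the Filippov selection equals the continuous field
  -- almost everywhere there.
  have hrep : ∀ r ∈ Set.Icc a b, x r i = x a i + ∫ u in a..r, agentField μ lam P (x u i) := by
    intro r hr
    have hrI := (hsub r hr.1 hr.2).1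
    have hga : IntervalIntegrable g volume 0 a := hg.mono_set (by
      rw [Set.uIcc_of_le haI.1.le, Set.uIcc_of_le hτ]
      exact Set.Icc_subset_Icc le_rfl haI.2.le)
    have hgr : IntervalIntegrable g volume 0 r := hg.mono_set (by
      rw [Set.uIcc_of_le hrI.1.le, Set.uIcc_of_le hτ]
      exact Set.Icc_subset_Icc le_rfl hrI.2.le)
    have hgar : IntervalIntegrable g volume a r := hga.symm.trans hgr
    have h1 : x r = x a + ∫ u in a..r, g u := by
      rw [hint r ⟨hrI.1.le, hrI.2.le⟩, hint a ⟨haI.1.le, haI.2.le⟩, add_assoc,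
        intervalIntegral.integral_add_adjacent_intervals hga hgar]
    have h2 : (∫ u in a..r, g u) i = ∫ u in a..r, g u i :=
      ((ContinuousLinearMap.proj (R := ℝ) i).intervalIntegral_comp_comm hgar).symm
    rw [h1, Pi.add_apply, h2]
    congr 1
    refine intervalIntegral.integral_congr_ae ?_
    have h3 := (ae_restrict_iff' measurableSet_Icc).1 hmem
    filter_upwards [h3] with u hu huI
    rw [Set.uIoc_of_le hr.1] at huI
    have huI' := hsub u huI.1.le (huI.2.trans hr.2)
    exact filippov_apply_eq hφ (hu ⟨huI'.1.1.le, huI'.1.2.le⟩) huI'.2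
  have hder : HasDerivAt (fun r => x a i + ∫ u in a..r, agentField μ lam P (x u i))
      (agentField μ lam P (x t i)) t := by
    refine HasDerivAt.const_add _ (intervalIntegral.integral_hasDerivAt_right ?_ ?_ ?_)
    · exact (hφc.mono (Set.Icc_subset_Icc le_rfl htb.le)).intervalIntegrable_of_Icc hat.le
    · exact (hφc.mono Set.Ioo_subset_Icc_self).stronglyMeasurableAtFilter isOpen_Ioo t ⟨hat, htb⟩
    · exact hφc.continuousAt (Icc_mem_nhds hat htb)
  refine hder.congr_of_eventuallyEq ?_
  filter_upwards [Icc_mem_nhds hat htb] with r hr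
  exact hrep r hr

/-! ### The transmitted vectors -/

lemma weight_nonneg {N : ℕ} (G : Digraph (Fin (N + 1))) (i j : Fin (N + 1)) :
    0 ≤ weight G i j := by
  unfold weight
  split_ifs <;> norm_num

lemma sum_weight_pos {N : ℕ} {G : Digraph (Fin (N + 1))} {i j : Fin (N + 1)} (hij : G.Adj i j) :
    0 < ∑ j, weight G i j := by
  have h1 : weight G i j = 1 := if_pos hij
  exact (by norm_num [h1] : 0 < weight G i j).trans_le
    (Finset.single_le_sum (fun j _ => weight_nonneg G i j) (Finset.mem_univ j))

namespace IsLeaderFollower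

variable {N n : ℕ} {G : Digraph (Fin (N + 1))}

lemma sum_weight_pos (hG : IsLeaderFollower G) {i : Fin (N + 1)} (hi : i ≠ 0) :
    0 < ∑ j, weight G i j := by
  rcases (Relation.TransGen.tail'_iff.1 (hG.reachable i hi)) with ⟨j, -, hj⟩
  exact NonOvershoot.sum_weight_pos hj

/-- Discrete maximum principle: a function on the followers that equals the average over its
neighbours and vanishes at the leader is nonpositive. -/
lemma nonpos_of_average (hG : IsLeaderFollower G) {d : Fin (N + 1) → ℝ} (h0 : d 0 = 0)
    (hd : ∀ i, i ≠ 0 → (∑ j, weight G i j) * d i = ∑ j, weight G i j * d j) (i : Fin (N + 1)) :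
    d i ≤ 0 := by
  obtain ⟨k, hk⟩ := Finite.exists_max d
  -- A maximal value that is an average of neighbouring values is attained at every neighbour;
  -- tracing a path back carries it to the leader.
  have hneigh : ∀ i j, G.Adj i j → d i = d k → d j = d k := by
    intro i j hij hi
    have hi0 : i ≠ 0 := by
      rintro rfl
      exact hG.leader_source j hij
    have h1 : ∑ j, weight G i j * (d k - d j) = 0 := by
      simp only [mul_sub, Finset.sum_sub_distrib, ← hd i hi0, hi, ← Finset.sum_mul, sub_self]
    have h2 := (Finset.sum_eq_zero_iff_of_nonneg fun j _ =>
      mul_nonneg (weight_nonneg G i j) (sub_nonneg.2 (hk j))).1 h1 j (Finset.mem_univ j)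
    have h3 : weight G i j = 1 := if_pos hij
    rw [h3, one_mul] at h2
    linarith
  have hpath : ∀ i, Relation.TransGen (fun j i => G.Adj i j) 0 i → d i = d k → d k = 0 := by
    intro i hi
    induction hi with
    | single hadj => exact fun hik => (hneigh _ _ hadj hik).symm.trans h0
    | tail _ hadj ih => exact fun hik => ih (hneigh _ _ hadj hik)
  have hk0 : d k = 0 := by
    by_cases hk' : k = 0
    · rw [hk', h0]
    · exact hpath k (hG.reachable k hk') rfl
  exact (hk i).trans hk0.le

lemma isTransmitted_sub (hG : IsLeaderFollower G) (x : Fin (N + 1) → Fin n → ℝ) :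
    IsTransmitted G x fun i => x i - x 0 := by
  refine ⟨sub_self _, fun i hi => ?_⟩
  simp only [sub_add_sub_cancel, ← Finset.sum_smul, smul_smul]
  rw [one_div, inv_mul_cancel₀ (hG.sum_weight_pos hi).ne', one_smul]

/-- Each coordinate of v_i - (x_i - x_0) is an average over neighbours and vanishes at the leader;
the maximum principle applies to it and to its negative. -/
lemma eq_sub_of_isTransmitted (hG : IsLeaderFollower G) {x v : Fin (N + 1) → Fin n → ℝ}
    (hv : IsTransmitted G x v) (i : Fin (N + 1)) : v i = x i - x 0 := by
  have havg : ∀ k i, i ≠ 0 → (∑ j, weight G i j) * (v i k - (x i k - x 0 k)) =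
      ∑ j, weight G i j * (v j k - (x j k - x 0 k)) := by
    intro k i hi
    have h1 := congrFun (hv.2 i hi) k
    simp only [Pi.smul_apply, Finset.sum_apply, Pi.add_apply, Pi.sub_apply, smul_eq_mul] at h1
    rw [h1, mul_sub, ← mul_assoc, mul_one_div_cancel (hG.sum_weight_pos hi).ne', one_mul,
      Finset.sum_mul, ← Finset.sum_sub_distrib]
    exact Finset.sum_congr rfl fun j _ => by ring
  have hv0 : ∀ k, v 0 k - (x 0 k - x 0 k) = 0 := fun k => by simp [hv.1]
  ext k
  have h1 := hG.nonpos_of_average (d := fun i => v i k - (x i k - x 0 k)) (hv0 k) (havg k) i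
  have h2 := hG.nonpos_of_average (d := fun i => -(v i k - (x i k - x 0 k)))
    (by simp only [hv0 k, neg_zero]) (fun i hi => by
      simp only [mul_neg, Finset.sum_neg_distrib, havg k i hi]) i
  simp only [Pi.sub_apply] at h1 h2 ⊢
  linarith

lemma isErrorField_agentField (hG : IsLeaderFollower G) (μ lam : ℝ)
    (P : Matrix (Fin n) (Fin n) ℝ) :
    IsErrorField G μ lam P fun e i => agentField μ lam P (e i) := by
  intro x v hv
  funext i
  simp only [consensusError, agentVelocity, agentField, if_neg (Fin.succ_ne_zero i), if_true,
    hG.eq_sub_of_isTransmitted hv, zero_smul, add_zero, Matrix.mulVec_sub]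
  abel

end IsLeaderFollower

/-! ### The error equation -/

namespace IsHomogeneousLoop

open IsMonotoneDilation

variable {n : ℕ} {μ lam : ℝ} {P : Matrix (Fin n) (Fin n) ℝ}

lemma hasGlobalSolutions (h : IsHomogeneousLoop μ lam P) (N : ℕ) :
    HasGlobalSolutions fun (e : Fin N → Fin n → ℝ) i => agentField μ lam P (e i) := by
  intro e₀
  choose x hx0 hx using fun i => h.exists_integral_solution (e₀ i)
  have hm := h.toIsMonotoneDilation
  refine ⟨fun t i => x i t, funext hx0, fun τ hτ => ?_⟩
  have hint : ∀ t ∈ Set.Icc 0 τ, IntervalIntegrable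
      (fun t (i : Fin N) => agentField μ lam P (x i t)) volume 0 t := by
    intro t ht
    have h1 : ∀ i, IntervalIntegrable (fun t => agentField μ lam P (x i t)) volume 0 t :=
      fun i => (hx i τ hτ).1.mono_set (by
        rw [Set.uIcc_of_le ht.1, Set.uIcc_of_le hτ.le]
        exact Set.Icc_subset_Icc le_rfl ht.2)
    exact ⟨Integrable.of_eval fun i => (h1 i).1, Integrable.of_eval fun i => (h1 i).2⟩
  refine ⟨fun t i => agentField μ lam P (x i t), hint τ ⟨hτ.le, le_rfl⟩, ?_, fun t ht => ?_⟩
  · exact Filter.Eventually.of_forall fun t =>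
      mem_filippov_of_odd (continuousOn_agentField hm) (agentField_neg hm) fun i => x i t
  · funext i
    have h1 := (hx i τ hτ).2 t ht
    have h2 := (ContinuousLinearMap.proj (R := ℝ) (φ := fun _ : Fin N => Fin n → ℝ)
      i).intervalIntegral_comp_comm (hint t ht)
    exact h1.trans (congrArg (x i 0 + ·) h2)

lemma lyapunovStable (h : IsHomogeneousLoop μ lam P) (N : ℕ) :
    LyapunovStable fun (e : Fin N → Fin n → ℝ) i => agentField μ lam P (e i) := by
  intro ε hε
  have hm := h.toIsMonotoneDilation
  obtain ⟨C, hC, hle⟩ := hm.exists_norm_le_homNorm h.degree_neg.le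
  -- The cap 1 is where the norm comparison is valid; the factor 2 yields a strict inequality.
  have hη : 0 < min 1 (ε / (2 * C)) := lt_min one_pos (by positivity)
  obtain ⟨δ, hδ, hball⟩ := Metric.continuousAt_iff.1
    (hm.continuous_homNorm.continuousAt (x := (0 : Fin n → ℝ))) _ hη
  refine ⟨δ, hδ, fun τ hτ x hx hx0 t ht => ?_⟩
  rw [pi_norm_lt_iff hε]
  intro i
  have hsol := hx.isAgentSolution hm hτ.le i
  have h1 := hball (x := x 0 i) (by
    rw [dist_zero_right]
    exact (norm_le_pi_norm (x 0) i).trans_lt hx0)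
  rw [homNorm_zero, dist_zero_right, Real.norm_of_nonneg (homNorm_nonneg _), lt_min_iff] at h1
  have h2 := h.homNorm_le_initial hsol ht
  have h3 := hle (x t i) (h2.trans h1.1.le)
  have h4 : C * homNorm μ P (x t i) ≤ C * (ε / (2 * C)) :=
    mul_le_mul_of_nonneg_left (h2.trans h1.2.le) hC.le
  have h5 : C * (ε / (2 * C)) = ε / 2 := by field_simp
  linarith

lemma globallyFiniteTimeStable (h : IsHomogeneousLoop μ lam P) (N : ℕ) :
    GloballyFiniteTimeStable fun (e : Fin N → Fin n → ℝ) i => agentField μ lam P (e i) := by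
  obtain ⟨T, hT, hsettle⟩ := h.exists_settlingTime
  -- The sum dominates every component's settling time; the 1 keeps it positive when N = 0.
  refine ⟨h.hasGlobalSolutions N, h.lyapunovStable N, fun e => 1 + ∑ i, T (e i), fun e => ?_,
    fun τ hτ x hx t ht hTt => ?_⟩
  · have := Finset.sum_nonneg fun i (_ : i ∈ Finset.univ) => (hT (e i)).le
    linarith
  · funext i
    have h1 : T (x 0 i) ≤ ∑ i, T (x 0 i) :=
      Finset.single_le_sum (f := fun i => T (x 0 i)) (fun j _ => (hT _).le) (Finset.mem_univ i)
    exact hsettle τ _ (hx.isAgentSolution h.toIsMonotoneDilation hτ.le i) t ht (by linarith)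

lemma strictlyPositivelyInvariant_coneHom (h : IsHomogeneousLoop μ lam P) (N : ℕ) :
    StrictlyPositivelyInvariant (fun (e : Fin N → Fin n → ℝ) i => agentField μ lam P (e i))
      (coneHom N μ lam P) :=
  fun _ hτ _ hx hx0 _ ht i => h.matH_homProj_nonneg
    (hx.isAgentSolution h.toIsMonotoneDilation hτ.le i) (hx0 i) ht

end IsHomogeneousLoop

/-! ### The cones -/

lemma IsMonotoneDilation.isHomogeneousCone_coneHom {n : ℕ} {μ : ℝ} {P : Matrix (Fin n) (Fin n) ℝ}
    (h : IsMonotoneDilation μ P) (N : ℕ) (lam : ℝ) : IsHomogeneousCone μ (coneHom N μ lam P) := by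
  refine ⟨⟨0, fun i => ?_⟩, fun e he s i => ?_⟩
  · simp [IsMonotoneDilation.homProj_zero]
  · rw [h.homProj_dil]
    exact he i

lemma eta1_dotProduct_nonpos {n : ℕ} (hn : 0 < n) {lam : ℝ} {z : Fin n → ℝ}
    (hz : 0 ≤ matH n lam *ᵥ z) : eta1 n ⬝ᵥ z ≤ 0 := by
  have h1 := hz ⟨0, hn⟩
  rw [matH_mulVec_apply, chainRow_zero, Pi.zero_apply] at h1
  linarith

lemma coneLin_subset_setSigma (N : ℕ) {n : ℕ} (hn : 0 < n) (lam : ℝ) :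
    coneLin N n lam ⊆ setSigma N n :=
  fun _ he i => eta1_dotProduct_nonpos hn (he i)

/-- The dilation is diagonal with positive entries, so projecting does not change the sign of the
first component. -/
lemma coneHom_subset_setSigma (N : ℕ) {n : ℕ} (hn : 0 < n) (μ lam : ℝ)
    (P : Matrix (Fin n) (Fin n) ℝ) : coneHom N μ lam P ⊆ setSigma N n := by
  intro e he i
  have h1 := eta1_dotProduct_nonpos hn (he i)
  rw [eta1_dotProduct hn, homProj_eq, dil_mulVec_apply] at h1
  rw [eta1_dotProduct hn]
  exact nonpos_of_mul_nonpos_right h1 (Real.exp_pos _)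

end NonOvershoot

theorem theorem3 (N n : ℕ) (hn : 1 ≤ n)
    (G : Digraph (Fin (N + 1))) (hG : IsLeaderFollower G)
    (μ : ℝ) (hμ : μ ∈ Set.Ico (-1 : ℝ) 0) (lam : ℝ) (hlam : 0 < lam)
    (P : Matrix (Fin n) (Fin n) ℝ) (hP : P.PosDef)
    (hPG : (P * generator n μ + generator n μ * P).PosDef)
    (hPA : (-(P * closedLoopMatrix n lam + (closedLoopMatrix n lam)ᵀ * P)).PosDef) :
    -- the canonical homogeneous norm and the transmitted vectors are well defined
    (∀ z : Fin n → ℝ, z ≠ 0 → ∃! s : ℝ, pNorm P (dil n μ (-s) *ᵥ z) = 1) ∧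
    (∀ x : Fin (N + 1) → Fin n → ℝ, ∃! v, IsTransmitted G x v) ∧
    -- the closed-loop error equation, its finite-time stability and its invariant cone
    (∃ f : (Fin N → Fin n → ℝ) → (Fin N → Fin n → ℝ),
      IsErrorField G μ lam P f ∧
      GloballyFiniteTimeStable f ∧
      StrictlyPositivelyInvariant f (coneHom N μ lam P)) ∧
    -- the cones
    IsHomogeneousCone μ (coneHom N μ lam P) ∧
    coneLin N n lam ⊆ setSigma N n ∧
    coneHom N μ lam P ⊆ setSigma N n ∧
    (∀ e₀ ∈ coneLin N n lam, (∀ i, pNorm P (e₀ i) ≤ 1) → e₀ ∈ coneHom N μ lam P) := by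
  have hm : IsMonotoneDilation μ P := ⟨hP, hPG⟩
  have h : IsHomogeneousLoop μ lam P := ⟨hm, hμ.1, hμ.2, hlam, hPA⟩
  exact ⟨fun z hz => hm.existsUnique_pNorm hz,
    fun x => ⟨fun i => x i - x 0, hG.isTransmitted_sub x,
      fun v hv => funext (hG.eq_sub_of_isTransmitted hv)⟩,
    ⟨fun e i => agentField μ lam P (e i), hG.isErrorField_agentField μ lam P,
      h.globallyFiniteTimeStable N, h.strictlyPositivelyInvariant_coneHom N⟩,
    hm.isHomogeneousCone_coneHom N lam, coneLin_subset_setSigma N hn lam,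
    coneHom_subset_setSigma N hn μ lam P,
    fun e₀ he₀ h1 i => h.matH_homProj_nonneg_of_pNorm_le (he₀ i) (h1 i)⟩
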